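/- **Setting.** Let $(\mathcal X,\rho_{\mathcal X})$ be a non-empty metric space, $\mathcal A$ a non-empty set, and $\rho$ a metric on $\mathcal X\times\mathcal A$; $\mathcal X$, $\mathcal A$ are measurable spaces, and open sets of $(\mathcal X,\rho_{\mathcal X})$ and of $(\mathcal X\times\mathcal A,\rho)$ are measurable. Write $\mathcal N_{\mathcal X}(\varepsilon)$, $\mathcal N_{\mathcal X\times\mathcal A}(\varepsilon)$ for the $\varepsilon$-covering numbers, and assume that $d_1,d_2\ge 0$ are covering dimensions: the covering numbers are finite with $\mathcal N_{\mathcal X\times\mathcal A}(\varepsilon)=O(\varepsilon^{-d_1})$ and $\mathcal N_{\mathcal X}(\varepsilon)=O(\varepsilon^{-d_2})$ for $\varepsilon\in(0,1]$. Let $H\ge 1$ and $K$ be integers, $[n]=\{1,\dots,n\}$, and let $P_h^k$ be transition kernels (Markov kernels) from $\mathcal X\times\mathcal A$ to $\mathcal X$ such that, for $h\in[H]$, $k\in[K]$, $z,z'\in\mathcal X\times\mathcal A$, $\mathbb W_1(P_h^k(\cdot|z),P_h^k(\cdot|z'))\le L_p\,\rho(z,z')$, where $L_p\ge 0$ and $\mathbb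 W_1(\mu,\nu)=\sup\{\int f\,d\mu-\int f\,d\nu: f\ 1\text{-Lipschitz}\}$. An arbitrary learner interacts with this non-stationary MDP: in episode $k\in[K]$ the initial state $x_1^k$ is arbitrary, at step $h\in[H]$ the learner chooses $a_h^k$ from the information available, and, given all the information $\mathcal F_h^k$ available once $a_h^k$ is chosen, $x_{h+1}^k$ has law $P_h^k(\cdot|x_h^k,a_h^k)$. Let $\Gamma:\mathbb N\times[0,\infty)\to[0,1]$ satisfy $\Gamma(t,y)\le C_1e^{-y^2/2}$, $|\Gamma(t,y)-\Gamma(t,y')|\le C_2|y-y'|$, and $\Gamma(t,y)\le C_3\eta^t$ for $t\ge W$, where $C_1>0$, $C_2\ge 1$, $C_3\ge0$, $\eta\in(0,1)$, $W\in\mathbb N$. Let $\beta,\sigma,L_Q>0$ with $L_Q\sigma\le 2H$. For $z\in\mathcal X\times\mathcal A$ and $s<k$ put $w_h^{k,s}(z)=\Gamma\big(k-s-1,\rho(z,(x_h^s,a_h^s))/\sigma\big)$, $\mathbf C_h^k(z)=\beta+\sum_{s=1}^{k-1}w_h^{k,s}(z)$, $\widetilde w_h^{k,s}=w_h^{k,s}/\mathbf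 C_h^k$, and, for $f:\mathcal X\to\mathbb R$, $$\widehat P_h^kf(z)=\sum_{s=1}^{k-1}\widetilde w_h^{k,s}(z)f(x_{h+1}^s),\qquad \overline P_h^kf(z)=\sum_{s=1}^{k-1}\widetilde w_h^{k,s}(z)P_h^sf(z)+\frac{\beta}{\mathbf C_h^k(z)}P_h^kf(z),$$ where $P_h^kf(z)=\int f(y)\,P_h^k(dy|z)$, and $$\mathbf{bias}_p(k,h)=L_Q\sum_{i=\max(1,k-W)}^{k-1}\ \sup_{z}\mathbb W_1\big(P_h^i(\cdot|z),P_h^{i+1}(\cdot|z)\big)+\frac{C_3H}{\beta}\,\frac{\eta^W}{1-\eta}.$$ Finally, with $\log^+u=\max(0,\log u)$, $$\square_3(k,\delta)=\log\Big(\tfrac{4e(2k+1)}{\delta}\,KH\,\mathcal N_{\mathcal X\times\mathcal A}\big(\tfrac{\sigma^{2+d_2}}{H^2K}\big)\big(\tfrac{2H}{L_Q\sigma}\big)^{\mathcal N_{\mathcal X}(\sigma)}\Big),$$ $$\theta_b^3(k,\delta)=\frac{2L_pL_Q\sigma}{H^2K}+\frac{4C_2}{H\beta}+\frac{14\,\square_3(k,\delta)C_2}{\beta^2},\qquad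 \theta_b^4(k,\delta)=32L_Q+6L_pL_Q\Big(1+\sqrt{\log^+(C_1k/\beta)}\Big).$$ **Lemma (Bernstein-type confidence bound).** Let $\delta\in(0,1)$. With probability at least $1-\delta$, for all $(x,a)\in\mathcal X\times\mathcal A$, $k\in[K]$, $h\in[H]$ and every $2L_Q$-Lipschitz $f:\mathcal X\to\mathbb R$ with $|f|\le 2H$, $$\big|(\widehat P_h^k-\overline P_h^k)f(x,a)\big|\le \frac1H P_h^k|f|(x,a)+\frac{14H^2C_2\square_3(k,\delta)+2\beta H}{\mathbf C_h^k(x,a)}+\theta_b^3(k,\delta)\,\sigma^{1+d_2}+\theta_b^4(k,\delta)\,\sigma+\frac2H\mathbf{bias}_p(k,h).$$ Moreover, $\square_3=\widetilde O(\mathcal N_{\mathcal X}(\sigma)+d_1d_2)$, $\theta_b^3=\widetilde O(\mathcal N_{\mathcal X}(\sigma)+d_1d_2+L_Q\sigma)$, $\theta_b^4=\widetilde O(L_Q)$ and $\mathcal N_{\mathcal X}(\sigma)=O(\sigma^{-d_2})$, in the following sense: there is a constant $c>0$ depending only on the two metric spaces, $d_1,d_2,H,C_1,C_2,\beta,L_p$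 such that for all $1\le k\le K$, $\delta\in(0,1)$, $\sigma\in(0,1]$ and $L_Q>0$ with $L_Q\sigma\le 2H$ the first three quantities are at most $c\Lambda$ times the stated expressions, with $\Lambda=\log\big(\frac{eK}{\delta\sigma}\cdot\frac{2H}{L_Q\sigma}\big)\ge 1$, and $\mathcal N_{\mathcal X}(\sigma)\le c\,\sigma^{-d_2}$. -/

import Mathlib

open MeasureTheory ProbabilityTheory

namespace KeRNS

noncomputable section

/-- The `ε`-covering number of a metric space `Z`: the least cardinality of a set `C ⊆ Z` such that
every point of `Z` is at distance at most `ε` from a point of `C` (used only when it is finite). -/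
def covNum (Z : Type*) [MetricSpace Z] (ε : ℝ) : ℕ :=
  (Metric.coveringNumber ε.toNNReal (Set.univ : Set Z)).toNat

/-- `d` is a covering dimension of `Z`: the `ε`-covering numbers are finite and `O(ε^{-d})`. -/
def HasCoveringDim (Z : Type*) [MetricSpace Z] (d : ℝ) : Prop :=
  0 ≤ d ∧ ∃ c : ℝ, ∀ ε : ℝ, 0 < ε → ε ≤ 1 →
    Metric.coveringNumber ε.toNNReal (Set.univ : Set Z) ≠ ⊤ ∧ (covNum Z ε : ℝ) ≤ c * ε ^ (-d)

/-- The 1-Wasserstein distance, in its dual (Kantorovich) form. -/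
def wass {X : Type*} [MetricSpace X] [MeasurableSpace X] (μ ν : Measure X) : ℝ :=
  ⨆ f : {f : X → ℝ // LipschitzWith 1 f}, ((∫ y, f.1 y ∂μ) - ∫ y, f.1 y ∂ν)

/-- Functions on `X` that are `L`-Lipschitz and bounded by `B` in absolute value. -/
def boundedLipschitz (X : Type*) [MetricSpace X] (L B : ℝ) : Set (X → ℝ) :=
  {f | LipschitzWith L.toNNReal f ∧ ∀ y, |f y| ≤ B}

/-- The properties of a base kernel `(t, z) ↦ Γ t z`, where `t` is the time lag and `z ≥ 0` is the
rescaled distance, with constants `C₁, C₂, C₃`, discount `η` and time window `W`. -/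
structure IsBaseKernel (Γ : ℕ → ℝ → ℝ) (C₁ C₂ C₃ η : ℝ) (W : ℕ) : Prop where
  nonneg : ∀ t z, 0 ≤ z → 0 ≤ Γ t z
  le_one : ∀ t z, 0 ≤ z → Γ t z ≤ 1
  le_gauss : ∀ t z, 0 ≤ z → Γ t z ≤ C₁ * Real.exp (-z ^ 2 / 2)
  lipschitz : ∀ t y z, 0 ≤ y → 0 ≤ z → |Γ t y - Γ t z| ≤ C₂ * |y - z|
  le_discount : ∀ t z, 0 ≤ z → W ≤ t → Γ t z ≤ C₃ * η ^ t

/-- `x k h`, `a k h` are the state and the action at step `h` of episode `k` of the interaction of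
an arbitrary learner with the episodic non-stationary MDP with transition kernels `P k h`. The
sigma-algebra `F (k, h)` contains all the information available once `a k h` has been chosen
(previous episodes and previous steps of episode `k`, possibly rewards and internal randomness).
Initial states are arbitrary. -/
structure IsInteraction {Ω X A : Type*} [mΩ : MeasurableSpace Ω] [MeasurableSpace X]
    [MeasurableSpace A] (μ : Measure Ω) (P : ℕ → ℕ → Kernel (X × A) X) (K H : ℕ)
    (F : Filtration (ℕ ×ₗ ℕ) mΩ) (x : ℕ → ℕ → Ω → X) (a : ℕ → ℕ → Ω → A) : Prop where
  state_adapted : ∀ k ∈ Finset.Icc 1 K, ∀ h ∈ Finset.Icc 1 (H + 1),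
    Measurable[F (toLex (k, h))] (x k h)
  action_adapted : ∀ k ∈ Finset.Icc 1 K, ∀ h ∈ Finset.Icc 1 H,
    Measurable[F (toLex (k, h))] (a k h)
  transition : ∀ k ∈ Finset.Icc 1 K, ∀ h ∈ Finset.Icc 1 H, ∀ B : Set X, MeasurableSet B →
    μ⟦(x k (h + 1)) ⁻¹' B | F (toLex (k, h))⟧
      =ᵐ[μ] fun ω => (P k h (x k h ω, a k h ω)).real B

section Estimators

variable {X A : Type*} [MetricSpace (X × A)]

/-- The weight of the visit at step `h` of the past episode `s`, at episode `k` and point `z`,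
along a realized trajectory `x`, `a`. -/
def weight (Γ : ℕ → ℝ → ℝ) (σ : ℝ) (x : ℕ → ℕ → X) (a : ℕ → ℕ → A) (k h s : ℕ) (z : X × A) : ℝ :=
  Γ (k - s - 1) (dist z (x s h, a s h) / σ)

/-- The generalized count: `β + ∑_{s<k}` of the weights. -/
def count (Γ : ℕ → ℝ → ℝ) (σ β : ℝ) (x : ℕ → ℕ → X) (a : ℕ → ℕ → A) (k h : ℕ) (z : X × A) : ℝ :=
  β + ∑ s ∈ Finset.Ico 1 k, weight Γ σ x a k h s z

/-- Normalized weights. -/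
def normWeight (Γ : ℕ → ℝ → ℝ) (σ β : ℝ) (x : ℕ → ℕ → X) (a : ℕ → ℕ → A) (k h s : ℕ)
    (z : X × A) : ℝ :=
  weight Γ σ x a k h s z / count Γ σ β x a k h z

/-- The estimated transitions applied to `f`: the weighted average of the `f (x s (h+1))`. -/
def estP (Γ : ℕ → ℝ → ℝ) (σ β : ℝ) (x : ℕ → ℕ → X) (a : ℕ → ℕ → A) (k h : ℕ) (f : X → ℝ)
    (z : X × A) : ℝ :=
  ∑ s ∈ Finset.Ico 1 k, normWeight Γ σ β x a k h s z * f (x s (h + 1))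

/-- The average MDP's transitions applied to `f`: the same weighted average of the true past
transitions, with the remaining mass `β / count` on the current one. -/
def avP [MeasurableSpace X] [MeasurableSpace A] (P : ℕ → ℕ → Kernel (X × A) X)
    (Γ : ℕ → ℝ → ℝ) (σ β : ℝ) (x : ℕ → ℕ → X) (a : ℕ → ℕ → A) (k h : ℕ) (f : X → ℝ)
    (z : X × A) : ℝ :=
  (∑ s ∈ Finset.Ico 1 k, normWeight Γ σ β x a k h s z * ∫ y, f y ∂(P s h z))
    + β / count Γ σ β x a k h z * ∫ y, f y ∂(P k h z)

end Estimators

/-- The temporal bias of the transitions. -/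
def biasP {X A : Type*} [MetricSpace X] [MeasurableSpace X] [MeasurableSpace A]
    (P : ℕ → ℕ → Kernel (X × A) X) (H W : ℕ) (LQ β C₃ η : ℝ) (k h : ℕ) : ℝ :=
  LQ * (∑ i ∈ Finset.Ico (max 1 (k - W)) k, ⨆ z : X × A, wass (P i h z) (P (i + 1) h z))
    + C₃ * H / β * (η ^ W / (1 - η))

/-- The logarithmic factor `□₃(k, δ)`. -/
def square3 (X A : Type*) [MetricSpace X] [MetricSpace (X × A)] (H K : ℕ) (LQ σ d₂ : ℝ)
    (k : ℕ) (δ : ℝ) : ℝ :=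
  Real.log (4 * Real.exp 1 * (2 * k + 1) / δ * (K * H)
    * covNum (X × A) (σ ^ (2 + d₂) / (H ^ 2 * K)) * (2 * H / (LQ * σ)) ^ covNum X σ)

/-- The factor `θ_b³(k, δ)`. -/
def theta3 (X A : Type*) [MetricSpace X] [MetricSpace (X × A)] (H K : ℕ) (Lp LQ σ β C₂ d₂ : ℝ)
    (k : ℕ) (δ : ℝ) : ℝ :=
  2 * Lp * LQ * σ / (H ^ 2 * K) + 4 * C₂ / (H * β)
    + 14 * square3 X A H K LQ σ d₂ k δ * C₂ / β ^ 2

/-- The factor `θ_b⁴(k, δ)`, which does not depend on `δ`. -/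
def theta4 (Lp LQ β C₁ : ℝ) (k : ℕ) : ℝ :=
  32 * LQ + 6 * Lp * LQ * (1 + Real.sqrt (Real.posLog (C₁ * k / β)))

end

end KeRNS

/-! The bound is a Freedman-type inequality made uniform by covering arguments. Fix `k`, `h`, a
point `z` and a function `g`. Given the information at the visit in episode `s`, `g (x s (h+1))` has
mean `∫ g` under the kernel at the visited pair. Subtract from its centred value `lam` times its
conditional variance `V`, with `lam = 1/(4H²)`. Since `e^t ≤ 1 + t + t²` for `|t| ≤ 1` and the
weights satisfy `w² ≤ w`, the conditional mean of the exponential of `lam * w` times this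
compensated deviation is at most `exp (lam² w² V - lam² w V) ≤ 1`. Hence the exponential of the
weighted sum has mean at most 1 (`integral_exp_sum_deviation_le`), and the Chernoff bound controls
the unnormalized sum by `4H² □₃` with high probability.

A union bound over `k`, `h`, a net of state-action pairs and a uniform-norm net of the Lipschitz
functions gives one event (`exists_event_deviationSum_le`). On it everything is deterministic.
Moving `z` to the net changes only the weights, which are Lipschitz (`deviationSum_le_of_dist_le`);
moving `f` to the net costs a multiple of `LQ * σ`.

The variance is at most `2H ∫ |g|`, so the compensation becomes `1/(2H)` times a mean of `|f|`.
Replacing the visited pair by `z` costs a Wasserstein term proportional to their distance, whose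
weighted average is `O(σ)` up to a logarithm thanks to the Gaussian tail
(`sum_normWeight_mul_dist_le`). Replacing the past kernels by the current one costs the temporal
bias (`sum_normWeight_mul_integral_le`). These pieces meet in `estP_sub_avP_le`. The orders of
magnitude follow by expanding the logarithm. -/

namespace KeRNS

/-! ### Finite covers and boundedness. -/

section Covering

variable {Z : Type*} [MetricSpace Z]

theorem HasCoveringDim.coveringNumber_ne_top {d : ℝ} (h : HasCoveringDim Z d) {ε : ℝ}
    (hε : 0 < ε) : Metric.coveringNumber ε.toNNReal (Set.univ : Set Z) ≠ ⊤ := by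
  obtain ⟨-, c, hc⟩ := h
  have h1 := (hc (min ε 1) (lt_min hε one_pos) (min_le_right _ _)).1
  exact ne_top_of_le_ne_top h1
    (Metric.coveringNumber_anti (Real.toNNReal_le_toNNReal (min_le_left _ _)))

theorem exists_finset_cover {ε : ℝ} (hε : 0 < ε)
    (h : Metric.coveringNumber ε.toNNReal (Set.univ : Set Z) ≠ ⊤) :
    ∃ C : Finset Z, C.card = covNum Z ε ∧ ∀ z, ∃ y ∈ C, dist z y ≤ ε := by
  have hfin := Metric.finite_minimalCover (ε := ε.toNNReal) (A := (Set.univ : Set Z))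
  refine ⟨hfin.toFinset, ?_, fun z => ?_⟩
  · rw [covNum, ← Metric.encard_minimalCover h, hfin.encard_eq_coe_toFinset_card]
    rfl
  · obtain ⟨y, hy, hzy⟩ := Metric.isCover_minimalCover h (Set.mem_univ z)
    refine ⟨y, by simpa using hy, ?_⟩
    have h2 : edist z y ≤ (ε.toNNReal : ENNReal) := hzy
    rw [edist_dist, ← ENNReal.ofReal_coe_nnreal, Real.coe_toNNReal _ hε.le] at h2
    exact (ENNReal.ofReal_le_ofReal_iff hε.le).1 h2

theorem HasCoveringDim.one_le_covNum [Nonempty Z] {d : ℝ} (h : HasCoveringDim Z d) {ε : ℝ}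
    (hε : 0 < ε) : 1 ≤ covNum Z ε := by
  obtain ⟨C, hC, hcov⟩ := exists_finset_cover hε (h.coveringNumber_ne_top hε)
  obtain ⟨y, hy, -⟩ := hcov (Classical.arbitrary Z)
  rw [← hC]
  exact Finset.card_pos.2 ⟨y, hy⟩

/-- A finite cover by unit balls is bounded. The diameter bound makes every supremum of Wasserstein
type below finite; an unbounded real supremum would take the default value 0. -/
theorem HasCoveringDim.exists_dist_le {d : ℝ} (h : HasCoveringDim Z d) :
    ∃ D : ℝ, ∀ x y : Z, dist x y ≤ D := by
  obtain ⟨C, -, hcov⟩ := exists_finset_cover one_pos (h.coveringNumber_ne_top one_pos)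
  have hb : Bornology.IsBounded (Set.univ : Set Z) := by
    refine ((Bornology.isBounded_biUnion_finset C (f := fun y => Metric.closedBall y 1)).2
      fun y _ => Metric.isBounded_closedBall).subset fun z _ => ?_
    obtain ⟨y, hy, hzy⟩ := hcov z
    exact Set.mem_biUnion hy hzy
  obtain ⟨D, hD⟩ := Metric.isBounded_iff.1 hb
  exact ⟨D, fun x y => hD (Set.mem_univ x) (Set.mem_univ y)⟩

end Covering

/-! ### Duality bounds for the Wasserstein distance. -/

section Wasserstein

variable {X : Type*} [MetricSpace X] [MeasurableSpace X] [OpensMeasurableSpace X]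

theorem integrable_of_abs_le {Y : Type*} [MeasurableSpace Y] {μ : Measure Y} [IsFiniteMeasure μ]
    {f : Y → ℝ} {B : ℝ} (hf : Measurable f) (hB : ∀ y, |f y| ≤ B) : Integrable f μ :=
  Integrable.of_bound hf.aestronglyMeasurable B (.of_forall hB)

theorem abs_integral_le {Y : Type*} [MeasurableSpace Y] {μ : Measure Y} [IsProbabilityMeasure μ]
    {f : Y → ℝ} {B : ℝ} (hB : ∀ y, |f y| ≤ B) : |∫ y, f y ∂μ| ≤ B := by
  simpa using norm_integral_le_of_norm_le_const (μ := μ) (f := f) (.of_forall hB)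

theorem abs_integral_sub_le {Y : Type*} [MeasurableSpace Y] {μ : Measure Y}
    [IsProbabilityMeasure μ] {f : Y → ℝ} (hf : Integrable f μ) {a B : ℝ}
    (hB : ∀ y, |f y - a| ≤ B) : |(∫ y, f y ∂μ) - a| ≤ B := by
  have h := abs_integral_le (μ := μ) hB
  rwa [integral_sub hf (integrable_const a), integral_const, probReal_univ, one_smul] at h

theorem abs_integral_sub_integral_le_of_lipschitz [Nonempty X] {D : ℝ}
    (hD : ∀ x y : X, dist x y ≤ D) {μ ν : Measure X} [IsProbabilityMeasure μ]
    [IsProbabilityMeasure ν] {f : X → ℝ} (hf : LipschitzWith 1 f) :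
    |(∫ y, f y ∂μ) - ∫ y, f y ∂ν| ≤ 2 * D := by
  let x₀ := Classical.arbitrary X
  have h1 : ∀ y, |f y - f x₀| ≤ D := fun y => by
    have := hf.dist_le_mul y x₀
    rw [Real.dist_eq] at this
    exact this.trans (by simpa using hD y x₀)
  have hm : Measurable f := hf.continuous.measurable
  have h2 : ∀ y, |f y| ≤ |f x₀| + D := fun y => by
    have := abs_sub_abs_le_abs_sub (f y) (f x₀)
    linarith [h1 y]
  have h3 := abs_integral_sub_le (integrable_of_abs_le (μ := μ) hm h2) h1
  have h4 := abs_integral_sub_le (integrable_of_abs_le (μ := ν) hm h2) h1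
  rw [abs_le] at *
  constructor <;> linarith [h3.1, h3.2, h4.1, h4.2]

theorem bddAbove_wass [Nonempty X] {D : ℝ} (hD : ∀ x y : X, dist x y ≤ D) (μ ν : Measure X)
    [IsProbabilityMeasure μ] [IsProbabilityMeasure ν] :
    BddAbove (Set.range fun f : {f : X → ℝ // LipschitzWith 1 f} =>
      (∫ y, f.1 y ∂μ) - ∫ y, f.1 y ∂ν) := by
  refine ⟨2 * D, ?_⟩
  rintro _ ⟨f, rfl⟩
  exact (le_abs_self _).trans (abs_integral_sub_integral_le_of_lipschitz hD f.2)

theorem wass_le [Nonempty X] {D : ℝ} (hD : ∀ x y : X, dist x y ≤ D) (μ ν : Measure X)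
    [IsProbabilityMeasure μ] [IsProbabilityMeasure ν] : wass μ ν ≤ 2 * D :=
  haveI : Nonempty {f : X → ℝ // LipschitzWith 1 f} := ⟨⟨fun _ => 0, LipschitzWith.const' 0⟩⟩
  ciSup_le fun f => (le_abs_self _).trans (abs_integral_sub_integral_le_of_lipschitz hD f.2)

theorem wass_nonneg [Nonempty X] {D : ℝ} (hD : ∀ x y : X, dist x y ≤ D) (μ ν : Measure X)
    [IsProbabilityMeasure μ] [IsProbabilityMeasure ν] : 0 ≤ wass μ ν :=
  le_ciSup_of_le (bddAbove_wass hD μ ν) ⟨fun _ => 0, LipschitzWith.const' 0⟩ (by simp)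

theorem integral_sub_integral_le_mul_wass [Nonempty X] {D : ℝ} (hD : ∀ x y : X, dist x y ≤ D)
    (μ ν : Measure X) [IsProbabilityMeasure μ] [IsProbabilityMeasure ν] {f : X → ℝ} {L : ℝ}
    (hL : 0 < L) (hf : LipschitzWith L.toNNReal f) :
    (∫ y, f y ∂μ) - ∫ y, f y ∂ν ≤ L * wass μ ν := by
  have hg : LipschitzWith 1 fun y => L⁻¹ * f y := by
    refine LipschitzWith.of_dist_le_mul fun x y => ?_
    have := hf.dist_le_mul x y
    rw [Real.coe_toNNReal _ hL.le, Real.dist_eq] at this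
    rw [Real.dist_eq, ← mul_sub, abs_mul, abs_of_pos (inv_pos.2 hL), NNReal.coe_one, one_mul,
      inv_mul_le_iff₀ hL]
    exact this
  have h := le_ciSup (bddAbove_wass hD μ ν) ⟨_, hg⟩
  simp only [integral_const_mul, ← mul_sub] at h
  rwa [inv_mul_le_iff₀ hL] at h

theorem abs_integral_sub_integral_le_mul_wass [Nonempty X] {D : ℝ}
    (hD : ∀ x y : X, dist x y ≤ D)
    (μ ν : Measure X) [IsProbabilityMeasure μ] [IsProbabilityMeasure ν] {f : X → ℝ} {L : ℝ}
    (hL : 0 < L) (hf : LipschitzWith L.toNNReal f) :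
    |(∫ y, f y ∂μ) - ∫ y, f y ∂ν| ≤ L * wass μ ν := by
  refine abs_le'.2 ⟨integral_sub_integral_le_mul_wass hD μ ν hL hf, ?_⟩
  have h := integral_sub_integral_le_mul_wass hD μ ν hL hf.neg
  simp only [Pi.neg_apply, integral_neg] at h
  linarith

end Wasserstein

/-! ### Uniform-norm nets of bounded Lipschitz functions. -/

section BoundedLipschitz

variable {X : Type*} [MetricSpace X] {L B : ℝ} {f : X → ℝ}

theorem neg_mem_boundedLipschitz (hf : f ∈ boundedLipschitz X L B) :
    (fun y => -f y) ∈ boundedLipschitz X L B :=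
  ⟨hf.1.neg, fun y => by simpa using hf.2 y⟩

theorem abs_mem_boundedLipschitz (hf : f ∈ boundedLipschitz X L B) :
    (fun y => |f y|) ∈ boundedLipschitz X L B := by
  refine ⟨LipschitzWith.of_dist_le_mul fun x y => ?_, fun y => by simpa using hf.2 y⟩
  refine le_trans ?_ (hf.1.dist_le_mul x y)
  rw [Real.dist_eq, Real.dist_eq]
  exact abs_abs_sub_abs_le _ _

theorem abs_sub_le_of_mem_boundedLipschitz (hL : 0 ≤ L) (hf : f ∈ boundedLipschitz X L B)
    (x y : X) : |f x - f y| ≤ L * dist x y := by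
  have := hf.1.dist_le_mul x y
  rwa [Real.coe_toNNReal _ hL, Real.dist_eq] at this

theorem measurable_of_mem_boundedLipschitz [MeasurableSpace X] [OpensMeasurableSpace X]
    (hf : f ∈ boundedLipschitz X L B) : Measurable f :=
  hf.1.continuous.measurable

/-- Truncating the floor at `m - 1` puts the endpoint `m` into the last unit cell, so that `[0, m]`
has exactly `m` cells of length at most 1. -/
theorem abs_sub_le_one_of_min_floor_eq {m : ℕ} {a b : ℝ} (ha : 0 ≤ a)
    (ham : a ≤ m) (hb : 0 ≤ b) (hbm : b ≤ m) (h : min ⌊a⌋₊ (m - 1) = min ⌊b⌋₊ (m - 1)) :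
    |a - b| ≤ 1 := by
  have h1 := Nat.floor_le ha
  have h2 := Nat.lt_floor_add_one a
  have h3 := Nat.floor_le hb
  have h4 := Nat.lt_floor_add_one b
  have key : ⌊a⌋₊ = ⌊b⌋₊ ∨ (m ≤ ⌊a⌋₊ + 1 ∧ m ≤ ⌊b⌋₊ + 1) := by omega
  rcases key with h5 | ⟨h5, h6⟩
  · rw [h5] at h1 h2
    rw [abs_le]; constructor <;> linarith
  · have h5' : (m : ℝ) ≤ ⌊a⌋₊ + 1 := by exact_mod_cast h5
    have h6' : (m : ℝ) ≤ ⌊b⌋₊ + 1 := by exact_mod_cast h6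
    rw [abs_le]; constructor <;> linarith

/-- A net of the bounded Lipschitz functions for the uniform norm, obtained by quantizing with `m`
levels the values at the points of a net of the domain. -/
theorem exists_finset_net_boundedLipschitz {σ : ℝ} (hL : 0 ≤ L) (hB : 0 < B) {m : ℕ}
    (hm : 1 ≤ m) (C : Finset X) (hC : ∀ x, ∃ y ∈ C, dist x y ≤ σ) :
    ∃ N : Finset (X → ℝ), (∀ g ∈ N, g ∈ boundedLipschitz X L B) ∧ N.card ≤ m ^ C.card ∧
      ∀ f ∈ boundedLipschitz X L B, ∃ g ∈ N, ∀ x, |f x - g x| ≤ 2 * L * σ + 2 * B / m := by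
  classical
  have hm0 : (0 : ℝ) < m := by exact_mod_cast hm
  let code : (X → ℝ) → (C → Fin m) := fun f y =>
    ⟨min ⌊(f y + B) * m / (2 * B)⌋₊ (m - 1), by omega⟩
  -- Each attained code is represented by a function of the class having that code, so the net stays
  -- inside the class; unattained codes get the zero function.
  let rep : (C → Fin m) → (X → ℝ) := fun c =>
    if hc : ∃ f ∈ boundedLipschitz X L B, code f = c then hc.choose else fun _ => 0
  have hrep : ∀ c, rep c ∈ boundedLipschitz X L B := fun c => by
    by_cases hc : ∃ f ∈ boundedLipschitz X L B, code f = c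
    · simp only [rep, dif_pos hc]; exact hc.choose_spec.1
    · simp only [rep, dif_neg hc]
      exact ⟨LipschitzWith.const' 0, fun y => by simpa using hB.le⟩
  refine ⟨Finset.univ.image rep, ?_, ?_, fun f hf => ⟨rep (code f), by simp, fun x => ?_⟩⟩
  · simp only [Finset.mem_image, Finset.mem_univ, true_and]
    rintro _ ⟨c, rfl⟩
    exact hrep c
  · refine Finset.card_image_le.trans ?_
    simp
  · have hc : ∃ g ∈ boundedLipschitz X L B, code g = code f := ⟨f, hf, rfl⟩
    have hcode : code (rep (code f)) = code f := by
      have : rep (code f) = hc.choose := by simp only [rep, dif_pos hc]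
      rw [this]; exact hc.choose_spec.2
    set g := rep (code f) with hg
    have hgm : g ∈ boundedLipschitz X L B := hrep _
    obtain ⟨y, hy, hxy⟩ := hC x
    have h1 := congrArg Fin.val (congrFun hcode ⟨y, hy⟩)
    have hrange : ∀ u ∈ boundedLipschitz X L B, 0 ≤ (u y + B) * m / (2 * B) ∧
        (u y + B) * m / (2 * B) ≤ m := fun u hu => by
      have := abs_le.1 (hu.2 y)
      refine ⟨div_nonneg (mul_nonneg (by linarith) hm0.le) (by linarith), ?_⟩
      rw [div_le_iff₀ (by linarith)]
      nlinarith
    have h2 := abs_sub_le_one_of_min_floor_eq (hrange g hgm).1 (hrange g hgm).2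
      (hrange f hf).1 (hrange f hf).2 h1
    have h3 : |f y - g y| ≤ 2 * B / m := by
      have h5 : (g y + B) * m / (2 * B) - (f y + B) * m / (2 * B)
          = (g y - f y) * (m / (2 * B)) := by ring
      rw [h5, abs_mul, abs_of_pos (by positivity : (0:ℝ) < m / (2 * B)), mul_div_assoc',
        div_le_one (by linarith), abs_sub_comm] at h2
      rwa [le_div_iff₀ hm0]
    have h4 := abs_sub_le_of_mem_boundedLipschitz hL hf x y
    have h5 := abs_sub_le_of_mem_boundedLipschitz hL hgm x y
    have h6 := mul_le_mul_of_nonneg_left hxy hL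
    rw [abs_le] at *
    constructor <;> linarith [h3.1, h3.2, h4.1, h4.2, h5.1, h5.2]

theorem one_le_two_mul_div {LQ σ : ℝ} {H : ℕ} (hLQ : 0 < LQ) (hσ : 0 < σ) (h : LQ * σ ≤ 2 * H) :
    1 ≤ 2 * H / (LQ * σ) :=
  (one_le_div (by positivity)).2 h

theorem exists_net_boundedLipschitz_of_covNum {d₂ LQ σ : ℝ} {H : ℕ}
    (hd₂ : HasCoveringDim X d₂) (hH : 1 ≤ H)
    (hLQ : 0 < LQ) (hσ : 0 < σ) (hLQσ : LQ * σ ≤ 2 * H) :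
    ∃ N : Finset (X → ℝ), (∀ g ∈ N, g ∈ boundedLipschitz X (2 * LQ) (2 * H)) ∧
      (N.card : ℝ) ≤ (2 * H / (LQ * σ)) ^ covNum X σ ∧
      ∀ f ∈ boundedLipschitz X (2 * LQ) (2 * H), ∃ g ∈ N, ∀ v, |f v - g v| ≤ 8 * (LQ * σ) := by
  have hH' : (1 : ℝ) ≤ H := by exact_mod_cast hH
  obtain ⟨C, hC, hcov⟩ := exists_finset_cover hσ (hd₂.coveringNumber_ne_top hσ)
  have hR := one_le_two_mul_div hLQ hσ hLQσ
  set R : ℝ := 2 * H / (LQ * σ) with hRdef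
  have hR0 : 0 ≤ R := by linarith
  have hm : 1 ≤ ⌊R⌋₊ := Nat.le_floor (by exact_mod_cast hR)
  have hm' : (1 : ℝ) ≤ ⌊R⌋₊ := by exact_mod_cast hm
  obtain ⟨N, hN, hcard, hnet⟩ := exists_finset_net_boundedLipschitz (L := 2 * LQ) (B := 2 * H)
    (by positivity) (by positivity) hm C hcov
  refine ⟨N, hN, ?_, fun f hf => ?_⟩
  · rw [← hC]
    calc (N.card : ℝ) ≤ (⌊R⌋₊ : ℝ) ^ C.card := by exact_mod_cast hcard
      _ ≤ R ^ C.card := by gcongr; exact Nat.floor_le hR0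
  · obtain ⟨g, hg, hfg⟩ := hnet f hf
    refine ⟨g, hg, fun v => (hfg v).trans ?_⟩
    -- As `R ≥ 1`, rounding down loses less than a factor 2. Quantization then costs at most `4 *
    -- (LQ * σ)`, as much as the net of the domain.
    have h1 : R < 2 * ⌊R⌋₊ := by linarith [Nat.lt_floor_add_one R]
    have h2 : 2 * (2 * (H : ℝ)) / ⌊R⌋₊ ≤ 4 * (LQ * σ) := by
      rw [div_le_iff₀ (by linarith)]
      rw [hRdef, div_lt_iff₀ (by positivity), ← hRdef] at h1
      linarith
    linarith

end BoundedLipschitz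

/-! ### Kernel weights and their localization at scale `σ`. -/

section Weights

variable {X A : Type*} [MetricSpace (X × A)] {Γ : ℕ → ℝ → ℝ} {C₁ C₂ C₃ η : ℝ} {W : ℕ}
  {σ β : ℝ} (x : ℕ → ℕ → X) (a : ℕ → ℕ → A) (k h : ℕ) (z : X × A)

theorem weight_nonneg (hΓ : IsBaseKernel Γ C₁ C₂ C₃ η W) (hσ : 0 < σ) (s : ℕ) :
    0 ≤ weight Γ σ x a k h s z :=
  hΓ.nonneg _ _ (by positivity)

theorem weight_le_one (hΓ : IsBaseKernel Γ C₁ C₂ C₃ η W) (hσ : 0 < σ) (s : ℕ) :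
    weight Γ σ x a k h s z ≤ 1 :=
  hΓ.le_one _ _ (by positivity)

theorem abs_weight_sub_weight_le (hΓ : IsBaseKernel Γ C₁ C₂ C₃ η W) (hC₂ : 0 ≤ C₂) (hσ : 0 < σ)
    (s : ℕ) (z' : X × A) :
    |weight Γ σ x a k h s z - weight Γ σ x a k h s z'| ≤ C₂ * (dist z z' / σ) := by
  refine (hΓ.lipschitz _ _ _ (by positivity) (by positivity)).trans
    (mul_le_mul_of_nonneg_left ?_ hC₂)
  rw [← sub_div, abs_div, abs_of_pos hσ]
  gcongr
  exact abs_dist_sub_le _ _ _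

theorem le_count (hΓ : IsBaseKernel Γ C₁ C₂ C₃ η W) (hσ : 0 < σ) :
    β ≤ count Γ σ β x a k h z :=
  le_add_of_nonneg_right (Finset.sum_nonneg fun s _ => weight_nonneg x a k h z hΓ hσ s)

theorem normWeight_nonneg (hΓ : IsBaseKernel Γ C₁ C₂ C₃ η W) (hσ : 0 < σ) (hβ : 0 < β) (s : ℕ) :
    0 ≤ normWeight Γ σ β x a k h s z :=
  div_nonneg (weight_nonneg x a k h z hΓ hσ s) (hβ.le.trans (le_count x a k h z hΓ hσ))

theorem sum_normWeight_le_one (hΓ : IsBaseKernel Γ C₁ C₂ C₃ η W) (hσ : 0 < σ) (hβ : 0 < β) :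
    ∑ s ∈ Finset.Ico 1 k, normWeight Γ σ β x a k h s z ≤ 1 := by
  have hc := hβ.trans_le (le_count x a k h z hΓ hσ)
  simp only [normWeight, ← Finset.sum_div]
  rw [div_le_one hc, count]
  linarith

/-- Bound `y` by `exp (y - 1)` and complete the square: the exponent becomes `-(y - 1)²/2 - 1/2`. -/
theorem mul_gaussian_le_one {u y : ℝ} (hy : 1 + √2 * u ≤ y) (hu : 0 ≤ u) :
    y * Real.exp (-y ^ 2 / 2) ≤ Real.exp (-u ^ 2) := by
  have h1 : y ≤ Real.exp (y - 1) := by linarith [Real.add_one_le_exp (y - 1)]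
  have h2 : 2 * u ^ 2 ≤ (y - 1) ^ 2 := by
    have h3 : 0 ≤ √2 * u := by positivity
    have h4 : (√2 * u) ^ 2 ≤ (y - 1) ^ 2 := by gcongr; linarith
    rwa [mul_pow, Real.sq_sqrt (by norm_num)] at h4
  calc y * Real.exp (-y ^ 2 / 2) ≤ Real.exp (y - 1) * Real.exp (-y ^ 2 / 2) := by gcongr
    _ = Real.exp (y - 1 + -y ^ 2 / 2) := (Real.exp_add _ _).symm
    _ ≤ _ := Real.exp_le_exp.2 (by nlinarith)

/-- A visit within `1 + √2 u` bandwidths pays its weight times that radius. Farther away the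
Gaussian tail leaves at most `β / k`, where `u` is chosen so that `C₁ exp (-u²) ≤ β / k`. Fewer than
`k` visits then add at most `β`, which the count absorbs. -/
theorem weight_mul_dist_le (hΓ : IsBaseKernel Γ C₁ C₂ C₃ η W) (hC₁ : 0 < C₁) (hσ : 0 < σ)
    (hβ : 0 < β) (hk : 1 ≤ k) (s : ℕ) :
    weight Γ σ x a k h s z * dist z (x s h, a s h) ≤
      σ * (weight Γ σ x a k h s z * (1 + √2 * √(Real.posLog (C₁ * k / β))) + β / k) := by
  have hk' : (0 : ℝ) < k := by exact_mod_cast hk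
  set y := dist z (x s h, a s h) / σ with hy
  have hy0 : 0 ≤ y := by positivity
  set u := √(Real.posLog (C₁ * k / β)) with hu
  set w := weight Γ σ x a k h s z with hw
  have hw0 : 0 ≤ w := weight_nonneg x a k h z hΓ hσ s
  have hd : dist z (x s h, a s h) = σ * y := by rw [hy]; field_simp
  rw [hd, mul_left_comm]
  refine mul_le_mul_of_nonneg_left ?_ hσ.le
  rcases le_total y (1 + √2 * u) with hyu | hyu
  · have : 0 ≤ β / k := by positivity
    nlinarith [mul_le_mul_of_nonneg_left hyu hw0]
  · have h1 : w ≤ C₁ * Real.exp (-y ^ 2 / 2) := hΓ.le_gauss _ _ hy0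
    have h2 := mul_gaussian_le_one hyu (Real.sqrt_nonneg _)
    have h3 : Real.exp (-u ^ 2) ≤ β / (C₁ * k) := by
      rw [hu, Real.sq_sqrt Real.posLog_nonneg, Real.exp_neg]
      rw [← inv_div (C₁ * k) β]
      refine inv_anti₀ (by positivity) ?_
      rw [← Real.log_le_iff_le_exp (by positivity)]
      exact le_max_right _ _
    have h4 : w * y ≤ β / k := by
      calc w * y ≤ C₁ * Real.exp (-y ^ 2 / 2) * y := by gcongr
        _ = C₁ * (y * Real.exp (-y ^ 2 / 2)) := by ring
        _ ≤ C₁ * (β / (C₁ * k)) := by gcongr; exact h2.trans h3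
        _ = β / k := by field_simp
    have : 0 ≤ w * (1 + √2 * u) := by positivity
    linarith

theorem sum_normWeight_mul_dist_le (hΓ : IsBaseKernel Γ C₁ C₂ C₃ η W) (hC₁ : 0 < C₁)
    (hσ : 0 < σ) (hβ : 0 < β) (hk : 1 ≤ k) :
    ∑ s ∈ Finset.Ico 1 k, normWeight Γ σ β x a k h s z * dist z (x s h, a s h) ≤
      2 * σ * (1 + √(Real.posLog (C₁ * k / β))) := by
  have hk' : (0 : ℝ) < k := by exact_mod_cast hk
  have hcβ := le_count (β := β) x a k h z hΓ hσ
  have hc := hβ.trans_le hcβ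
  set u := √(Real.posLog (C₁ * k / β)) with hu
  have hu0 : 0 ≤ u := Real.sqrt_nonneg _
  have h1 : ∑ s ∈ Finset.Ico 1 k, weight Γ σ x a k h s z * dist z (x s h, a s h) ≤
      σ * ((count Γ σ β x a k h z - β) * (1 + √2 * u) + β) := by
    calc _ ≤ ∑ s ∈ Finset.Ico 1 k, σ * (weight Γ σ x a k h s z * (1 + √2 * u) + β / k) :=
          Finset.sum_le_sum fun s _ => weight_mul_dist_le x a k h z hΓ hC₁ hσ hβ hk s
      _ = σ * ((count Γ σ β x a k h z - β) * (1 + √2 * u) + (k - 1 : ℕ) * (β / k)) := by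
          rw [← Finset.mul_sum, Finset.sum_add_distrib, ← Finset.sum_mul, Finset.sum_const,
            Nat.card_Ico, nsmul_eq_mul, count, add_sub_cancel_left]
      _ ≤ _ := by
          have : ((k - 1 : ℕ) : ℝ) ≤ k := by exact_mod_cast Nat.sub_le _ _
          have h2 : ((k - 1 : ℕ) : ℝ) * (β / k) ≤ k * (β / k) := by gcongr
          rw [mul_div_cancel₀ _ hk'.ne'] at h2
          gcongr
  simp only [normWeight, div_mul_eq_mul_div, ← Finset.sum_div]
  rw [div_le_iff₀ hc]
  refine h1.trans ?_
  have hs : √2 ≤ 2 := by rw [Real.sqrt_le_left (by norm_num)]; norm_num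
  have h3 : √2 * u ≤ 2 * u := by gcongr
  have h4 : (count Γ σ β x a k h z - β) * (1 + √2 * u) ≤
      count Γ σ β x a k h z * (1 + 2 * u) := by
    gcongr
    linarith
  have h5 : σ * ((count Γ σ β x a k h z - β) * (1 + √2 * u) + β) ≤
    σ * (count Γ σ β x a k h z * (1 + 2 * u) + count Γ σ β x a k h z) := by
    gcongr
  linarith

end Weights

/-! ### Temporal drift of the kernels. -/

section Bias

variable {X A : Type*} [Nonempty X] [MetricSpace X] [MeasurableSpace X] [OpensMeasurableSpace X]
  [MeasurableSpace A]
  {P : ℕ → ℕ → Kernel (X × A) X} [∀ k h, IsMarkovKernel (P k h)] {D : ℝ}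

theorem wass_le_iSup_wass (hD : ∀ x y : X, dist x y ≤ D) (i h : ℕ) (z : X × A) :
    wass (P i h z) (P (i + 1) h z) ≤ ⨆ z : X × A, wass (P i h z) (P (i + 1) h z) := by
  refine le_ciSup (f := fun z => wass (P i h z) (P (i + 1) h z)) ⟨2 * D, ?_⟩ z
  rintro _ ⟨z, rfl⟩
  exact wass_le hD _ _

theorem iSup_wass_nonneg (hD : ∀ x y : X, dist x y ≤ D) (i h : ℕ) :
    0 ≤ ⨆ z : X × A, wass (P i h z) (P (i + 1) h z) :=
  Real.iSup_nonneg fun _ => wass_nonneg hD _ _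

theorem abs_integral_sub_integral_le_sum_iSup_wass (hD : ∀ x y : X, dist x y ≤ D) {L : ℝ}
    (hL : 0 < L) {g : X → ℝ} (hg : LipschitzWith L.toNNReal g) (h s : ℕ) (z : X × A) {k : ℕ}
    (hsk : s ≤ k) : |(∫ y, g y ∂(P s h z)) - ∫ y, g y ∂(P k h z)| ≤
      L * ∑ i ∈ Finset.Ico s k, ⨆ z : X × A, wass (P i h z) (P (i + 1) h z) := by
  induction k, hsk using Nat.le_induction with
  | base => simp
  | succ k hsk ih =>
    rw [Finset.sum_Ico_succ_top hsk, mul_add]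
    refine (abs_sub_le _ (∫ y, g y ∂(P k h z)) _).trans (add_le_add ih ?_)
    exact (abs_integral_sub_integral_le_mul_wass hD _ _ hL hg).trans
      (mul_le_mul_of_nonneg_left (wass_le_iSup_wass hD k h z) hL.le)

/-- Distinct past episodes have distinct lags, so this is part of a geometric tail. -/
theorem sum_pow_lag_le {η : ℝ} (hη₀ : 0 < η) (hη₁ : η < 1) (k W : ℕ) :
    ∑ s ∈ Finset.Ico 1 k, (if W ≤ k - s - 1 then η ^ (k - s - 1) else 0) ≤ η ^ W / (1 - η) := by
  rw [← Finset.sum_filter]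
  have hinj : Set.InjOn (fun s => k - s - 1)
      ((Finset.Ico 1 k).filter fun s => W ≤ k - s - 1 : Finset ℕ) := by
    intro s hs t ht hst
    simp only [Finset.coe_filter, Finset.mem_Ico, Set.mem_ofPred_eq] at hs ht hst
    omega
  rw [← Finset.sum_image (f := fun j => η ^ j) hinj]
  refine le_trans (Finset.sum_le_sum_of_subset_of_nonneg (t := Finset.Ico W k) ?_
    fun _ _ _ => by positivity) (geom_sum_Ico_le_of_lt_one hη₀.le hη₁)
  intro j hj
  simp only [Finset.mem_image, Finset.mem_filter, Finset.mem_Ico] at hj ⊢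
  omega

theorem biasP_nonneg (hD : ∀ x y : X, dist x y ≤ D) {H W k h : ℕ} {LQ β C₃ η : ℝ}
    (hLQ : 0 < LQ) (hβ : 0 < β) (hC₃ : 0 ≤ C₃) (hη₀ : 0 < η) (hη₁ : η < 1) :
    0 ≤ biasP P H W LQ β C₃ η k h := by
  have h1 : 0 < 1 - η := by linarith
  have h2 : 0 ≤ ∑ i ∈ Finset.Ico (max 1 (k - W)) k,
      ⨆ z : X × A, wass (P i h z) (P (i + 1) h z) :=
    Finset.sum_nonneg fun i _ => iSup_wass_nonneg hD i h
  rw [biasP]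
  positivity

/-- Recent kernels are compared with the current one by telescoping over episodes. Visits of lag at
least `W` are not compared: their integral is at most `2H` and their normalized weight at most
`(C₃/β) η^lag`. -/
theorem sum_normWeight_mul_integral_le [MetricSpace (X × A)] {Γ : ℕ → ℝ → ℝ}
    {C₁ C₂ C₃ η : ℝ} {W : ℕ} (hΓ : IsBaseKernel Γ C₁ C₂ C₃ η W) (hD : ∀ x y : X, dist x y ≤ D)
    {H : ℕ} {LQ σ β : ℝ}
    (hLQ : 0 < LQ) (hσ : 0 < σ) (hβ : 0 < β) (hC₃ : 0 ≤ C₃) (hη₀ : 0 < η) (hη₁ : η < 1)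
    {g : X → ℝ} (hg : g ∈ boundedLipschitz X (2 * LQ) (2 * H)) (hg0 : ∀ y, 0 ≤ g y)
    (x : ℕ → ℕ → X) (a : ℕ → ℕ → A) (k h : ℕ) (z : X × A) :
    ∑ s ∈ Finset.Ico 1 k, normWeight Γ σ β x a k h s z * ∫ y, g y ∂(P s h z) ≤
      (∫ y, g y ∂(P k h z)) + 2 * biasP P H W LQ β C₃ η k h := by
  set S := ∑ i ∈ Finset.Ico (max 1 (k - W)) k, ⨆ z : X × A, wass (P i h z) (P (i + 1) h z)
    with hS
  have hS0 : 0 ≤ S := Finset.sum_nonneg fun i _ => iSup_wass_nonneg hD i h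
  have hcβ := le_count (β := β) x a k h z hΓ hσ
  have hI : ∀ s, 0 ≤ ∫ y, g y ∂(P s h z) ∧ ∫ y, g y ∂(P s h z) ≤ 2 * H := fun s =>
    ⟨integral_nonneg hg0, (abs_le.1 (abs_integral_le hg.2)).2⟩
  have hterm : ∀ s ∈ Finset.Ico 1 k,
      normWeight Γ σ β x a k h s z * ∫ y, g y ∂(P s h z) ≤
        normWeight Γ σ β x a k h s z * ((∫ y, g y ∂(P k h z)) + 2 * LQ * S)
          + 2 * H * (C₃ / β) * (if W ≤ k - s - 1 then η ^ (k - s - 1) else 0) := by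
    intro s hs
    rw [Finset.mem_Ico] at hs
    have hn := normWeight_nonneg x a k h z hΓ hσ hβ s
    split_ifs with hW
    · have h1 : normWeight Γ σ β x a k h s z ≤ C₃ / β * η ^ (k - s - 1) := by
        rw [normWeight, div_mul_eq_mul_div]
        exact div_le_div₀ (by positivity) (hΓ.le_discount _ _ (by positivity) hW) hβ hcβ
      have h2 : normWeight Γ σ β x a k h s z * ∫ y, g y ∂(P s h z) ≤
          C₃ / β * η ^ (k - s - 1) * (2 * H) :=
        mul_le_mul h1 (hI s).2 (hI s).1 (by positivity)
      have h3 : 0 ≤ normWeight Γ σ β x a k h s z * ((∫ y, g y ∂(P k h z)) + 2 * LQ * S) :=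
        mul_nonneg hn (add_nonneg (hI k).1 (by positivity))
      linarith
    · rw [mul_zero, add_zero]
      refine mul_le_mul_of_nonneg_left ?_ hn
      have h1 := abs_integral_sub_integral_le_sum_iSup_wass (P := P) hD
        (by positivity : 0 < 2 * LQ) hg.1 h s z hs.2.le
      -- A lag `k - s - 1 < W` means `s ≥ k - W`, so the telescoping range lies in the window of
      -- `S`.
      have h2 : ∑ i ∈ Finset.Ico s k, ⨆ z : X × A, wass (P i h z) (P (i + 1) h z) ≤ S := by
        refine Finset.sum_le_sum_of_subset_of_nonneg ?_ fun i _ _ => iSup_wass_nonneg hD i h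
        intro i hi
        simp only [Finset.mem_Ico] at hi ⊢
        omega
      have h3 := mul_le_mul_of_nonneg_left h2 (by positivity : 0 ≤ 2 * LQ)
      linarith [(abs_le.1 h1).2]
  refine (Finset.sum_le_sum hterm).trans ?_
  rw [Finset.sum_add_distrib, ← Finset.sum_mul, ← Finset.mul_sum, biasP]
  have h1 := sum_normWeight_le_one x a k h z hΓ hσ hβ
  have h2 : 0 ≤ (∫ y, g y ∂(P k h z)) + 2 * LQ * S := add_nonneg (hI k).1 (by positivity)
  have h3 := mul_le_mul_of_nonneg_right h1 h2
  have h4 := mul_le_mul_of_nonneg_left (sum_pow_lag_le hη₀ hη₁ k W)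
    (by positivity : 0 ≤ 2 * (H : ℝ) * (C₃ / β))
  have h5 : 2 * (H : ℝ) * (C₃ / β) * (η ^ W / (1 - η)) =
    2 * (C₃ * H / β * (η ^ W / (1 - η))) := by ring
  linarith

end Bias

/-! ### From conditional probabilities to conditional expectations. -/

section ConditionalLaw

variable {Ω Y Z : Type*} {m mΩ : MeasurableSpace Ω} [MeasurableSpace Y] [MeasurableSpace Z]
  {μ : Measure Ω} [IsProbabilityMeasure μ] {κ : Kernel Z Y} [IsMarkovKernel κ] {z : Ω → Z}
  {y : Ω → Y}

/-- If `κ (z ·)` is the conditional law of `y` given `m`, then the conditional expectation of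
`g ∘ y` is the integral of `g` against it. -/
theorem condExp_comp_ae_eq_integral (hm : m ≤ mΩ) (hz : Measurable[m] z) (hy : Measurable y)
    (hlaw : ∀ B : Set Y, MeasurableSet B → μ⟦y ⁻¹' B | m⟧ =ᵐ[μ] fun ω => (κ (z ω)).real B)
    {g : Y → ℝ} {b : ℝ} (hg : Measurable g) (hb : ∀ v, |g v| ≤ b) :
    μ[fun ω => g (y ω) | m] =ᵐ[μ] fun ω => ∫ v, g v ∂(κ (z ω)) := by
  have hz' : Measurable z := hz.mono hm le_rfl
  have hint : Integrable (fun ω => g (y ω)) μ :=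
    integrable_of_abs_le (hg.comp hy) fun ω => hb _
  have hGm : StronglyMeasurable fun u => ∫ v, g v ∂(κ u) :=
    hg.stronglyMeasurable.integral_kernel
  have hG : StronglyMeasurable[m] fun ω => ∫ v, g v ∂(κ (z ω)) := hGm.comp_measurable hz
  symm
  refine ae_eq_condExp_of_forall_setIntegral_eq hm hint
    (fun s _ _ => (integrable_of_abs_le (hG.mono hm).measurable
      fun ω => abs_integral_le hb).integrableOn) (fun s hs _ => ?_) hG.aestronglyMeasurable
  have hs' : MeasurableSet s := hm s hs
  -- On each event `s` of `m`, the hypothesis on indicators is an equality of measures on `Y`: the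
  -- law of `y` is the mixture of `κ` over the law of `z`. Integrating `g` against both sides avoids
  -- approximating `g` by simple functions.
  have hmeas : (κ ∘ₖ Kernel.const Unit ((μ.restrict s).map z)) () = (μ.restrict s).map y := by
    ext B hB
    rw [Kernel.comp_apply' _ _ _ hB, Kernel.const_apply,
      lintegral_map (Kernel.measurable_coe κ hB) hz', Measure.map_apply hy hB,
      Measure.restrict_apply (hy hB)]
    have h1 : ∫ ω in s, (κ (z ω)).real B ∂μ = μ.real (y ⁻¹' B ∩ s) := by
      rw [← setIntegral_congr_ae hs' ((hlaw B hB).mono fun ω hω _ => hω),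
        setIntegral_condExp hm ((integrable_const (1 : ℝ)).indicator (hy hB)) hs,
        setIntegral_indicator (hy hB), setIntegral_const, smul_eq_mul, mul_one, Set.inter_comm]
    have h2 : ∫⁻ ω in s, κ (z ω) B ∂μ ≠ ⊤ := by
      refine ((lintegral_mono fun ω => (prob_le_one : κ (z ω) B ≤ 1)).trans_lt ?_).ne
      simp [measure_lt_top]
    have h3 := integral_toReal (μ := μ.restrict s) (f := fun ω => κ (z ω) B)
      ((Kernel.measurable_coe κ hB).comp hz').aemeasurable
      (.of_forall fun ω => measure_lt_top _ _)
    rw [← ENNReal.toReal_eq_toReal_iff' h2 (measure_ne_top _ _), ← h3]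
    exact h1
  have h3 := Kernel.integral_comp (η := κ) (κ := Kernel.const Unit ((μ.restrict s).map z))
    (a := ()) (f := g) (by
      rw [hmeas]
      have := Measure.isFiniteMeasure_map (μ.restrict s) y
      exact integrable_of_abs_le hg hb)
  rw [hmeas, Kernel.const_apply, integral_map hz'.aemeasurable hGm.aestronglyMeasurable,
    integral_map hy.aemeasurable hg.aestronglyMeasurable] at h3
  exact h3.symm

theorem integral_mul_comp_eq (hm : m ≤ mΩ) (hz : Measurable[m] z) (hy : Measurable y)
    (hlaw : ∀ B : Set Y, MeasurableSet B → μ⟦y ⁻¹' B | m⟧ =ᵐ[μ] fun ω => (κ (z ω)).real B)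
    {g : Y → ℝ} {b c : ℝ} (hg : Measurable g) (hb : ∀ v, |g v| ≤ b) {U : Ω → ℝ}
    (hU : Measurable[m] U) (hc : ∀ ω, |U ω| ≤ c) :
    ∫ ω, U ω * g (y ω) ∂μ = ∫ ω, U ω * ∫ v, g v ∂(κ (z ω)) ∂μ := by
  have hi1 : Integrable (fun ω => g (y ω)) μ :=
    integrable_of_abs_le (hg.comp hy) fun ω => hb _
  have hi2 : Integrable (U * fun ω => g (y ω)) μ :=
    hi1.bdd_mul (hU.mono hm le_rfl).aestronglyMeasurable (.of_forall hc)
  calc ∫ ω, U ω * g (y ω) ∂μ = ∫ ω, (μ[U * fun ω => g (y ω) | m]) ω ∂μ :=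
        (integral_condExp hm).symm
    _ = _ := integral_congr_ae (by
        filter_upwards [condExp_mul_of_stronglyMeasurable_left hU.stronglyMeasurable hi2 hi1,
          condExp_comp_ae_eq_integral hm hz hy hlaw hg hb] with ω h1 h2
        rw [h1, Pi.mul_apply, h2])

end ConditionalLaw

/-! ### Variance-compensated deviations. -/

section Deviation

theorem abs_sq_le_of_abs_le {Y : Type*} {f : Y → ℝ} {b : ℝ} (hb : ∀ v, |f v| ≤ b) (v : Y) :
    |f v ^ 2| ≤ b ^ 2 := by
  rw [abs_pow]; exact pow_le_pow_left₀ (abs_nonneg _) (hb v) 2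

variable {Y : Type*} [MeasurableSpace Y]

/-- The variance of `f` under the probability measure `ν`. -/
noncomputable def varOf (ν : Measure Y) (f : Y → ℝ) : ℝ := (∫ v, f v ^ 2 ∂ν) - (∫ v, f v ∂ν) ^ 2

/-- The deviation of `f v` from its mean, compensated by a multiple of the variance. -/
noncomputable def deviation (lam : ℝ) (ν : Measure Y) (f : Y → ℝ) (v : Y) : ℝ :=
  f v - (∫ v, f v ∂ν) - lam * varOf ν f

variable {ν : Measure Y} [IsProbabilityMeasure ν] {f : Y → ℝ} {b : ℝ}

theorem varOf_nonneg (hf : Measurable f) (hb : ∀ v, |f v| ≤ b) : 0 ≤ varOf ν f := by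
  have h1 := integrable_of_abs_le (μ := ν) hf hb
  have h2 := integrable_of_abs_le (μ := ν) (hf.pow_const 2) (abs_sq_le_of_abs_le hb)
  have h3 : 0 ≤ ∫ v, (f v - ∫ v, f v ∂ν) ^ 2 ∂ν := integral_nonneg fun v => sq_nonneg _
  have h4 : ∫ v, (f v - ∫ v, f v ∂ν) ^ 2 ∂ν = varOf ν f := by
    have : ∀ v, (f v - ∫ v, f v ∂ν) ^ 2
        = f v ^ 2 - 2 * (∫ v, f v ∂ν) * f v + (∫ v, f v ∂ν) ^ 2 := fun v => by ring
    have h5 : Integrable (fun v => f v ^ 2 - 2 * (∫ v, f v ∂ν) * f v) ν :=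
      h2.sub (h1.const_mul _)
    simp only [this]
    rw [integral_add h5 (integrable_const _), integral_sub h2 (h1.const_mul _),
      integral_const_mul, integral_const, probReal_univ,
      one_smul, varOf]
    ring
  rwa [h4] at h3

/-- Since `f² ≤ b |f|`, the variance can be traded for a mean of `|f|`; this is the source of the
term `1/H * ∫ |f|` in the final bound. -/
theorem varOf_le (hf : Measurable f) (hb : ∀ v, |f v| ≤ b) :
    varOf ν f ≤ b * ∫ v, |f v| ∂ν := by
  have h1 := integrable_of_abs_le (μ := ν) (hf.pow_const 2) (abs_sq_le_of_abs_le hb)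
  have h2 := (integrable_of_abs_le (μ := ν) hf hb).abs
  have h3 : ∫ v, f v ^ 2 ∂ν ≤ ∫ v, b * |f v| ∂ν := by
    refine integral_mono h1 (h2.const_mul b) fun v => ?_
    simp only
    rw [← sq_abs, sq]
    exact mul_le_mul_of_nonneg_right (hb v) (abs_nonneg _)
  rw [integral_const_mul] at h3
  rw [varOf]
  linarith [sq_nonneg (∫ v, f v ∂ν)]

/-- The compensation by the variance does not increase the range. -/
theorem abs_deviation_le {H lam : ℝ} (hlam0 : 0 ≤ lam) (hlam : 4 * H * lam ≤ 1)
    (hf : Measurable f) (hb : ∀ v, |f v| ≤ 2 * H) (v : Y) : |deviation lam ν f v| ≤ 4 * H := by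
  have h0 := varOf_nonneg (ν := ν) hf hb
  set p := ∫ v, f v ∂ν with hp
  have hp' := abs_le.1 (abs_integral_le (μ := ν) hb)
  rw [← hp] at hp'
  have hv := abs_le.1 (hb v)
  have h1 : varOf ν f ≤ (2 * H) ^ 2 - p ^ 2 := by
    have := (abs_le.1 (abs_integral_le (μ := ν) (abs_sq_le_of_abs_le hb))).2
    rw [varOf]; linarith
  -- The variance is at most `(2H + p)(2H - p)` and `lam * (2H + p) ≤ 1`. Hence the lower bound only
  -- drops to `f v - 2H ≥ -4H`.
  have h2 : lam * varOf ν f ≤ 2 * H - p := by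
    calc lam * varOf ν f ≤ lam * ((2 * H) ^ 2 - p ^ 2) := by gcongr
      _ = lam * (2 * H + p) * (2 * H - p) := by ring
      _ ≤ lam * (4 * H) * (2 * H - p) := by
          refine mul_le_mul_of_nonneg_right ?_ (by linarith)
          exact mul_le_mul_of_nonneg_left (by linarith) hlam0
      _ ≤ 1 * (2 * H - p) := mul_le_mul_of_nonneg_right (by linarith) (by linarith)
      _ = _ := one_mul _
  have h3 : 0 ≤ lam * varOf ν f := mul_nonneg hlam0 h0
  rw [deviation, ← hp, abs_le]
  constructor <;> linarith

end Deviation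

/-! ### The exponential supermartingale. -/

section Supermartingale

variable {Ω Y Z : Type*} {m mΩ : MeasurableSpace Ω} [MeasurableSpace Y] [MeasurableSpace Z]
  {μ : Measure Ω} [IsProbabilityMeasure μ]

theorem measurable_deviation {Z : Type*} [MeasurableSpace Z] {κ : Kernel Z Y} {z : Ω → Z}
    {y : Ω → Y} (hz : Measurable z) (hy : Measurable y) {f : Y → ℝ} (hf : Measurable f)
    (lam : ℝ) : Measurable fun ω => deviation lam (κ (z ω)) f (y ω) := by
  have h1 : Measurable fun ω => ∫ v, f v ∂(κ (z ω)) :=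
    (hf.stronglyMeasurable.integral_kernel.comp_measurable hz).measurable
  have h2 : Measurable fun ω => ∫ v, f v ^ 2 ∂(κ (z ω)) :=
    ((hf.pow_const 2).stronglyMeasurable.integral_kernel.comp_measurable hz).measurable
  exact ((hf.comp hy).sub h1).sub ((h2.sub (h1.pow_const 2)).const_mul lam)

/-- One step of the supermartingale, with `E` the exponential accumulated so far. A quadratic bound
on the exponential is linear in `f (y ω)` and `f (y ω)²`, with `m`-measurable coefficients, so only
conditional means of these two are needed. -/
theorem integral_mul_exp_deviation_le {κ : Kernel Z Y} [IsMarkovKernel κ] {z : Ω → Z}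
    {y : Ω → Y} (hm : m ≤ mΩ) (hz : Measurable[m] z) (hy : Measurable y)
    (hlaw : ∀ B : Set Y, MeasurableSet B → μ⟦y ⁻¹' B | m⟧ =ᵐ[μ] fun ω => (κ (z ω)).real B)
    {f : Y → ℝ} {H lam : ℝ} (hlam0 : 0 ≤ lam) (hlam : 4 * H * lam ≤ 1)
    (hf : Measurable f)
    (hb : ∀ v, |f v| ≤ 2 * H) {w E : Ω → ℝ} (hw : Measurable[m] w) (hw0 : ∀ ω, 0 ≤ w ω)
    (hw1 : ∀ ω, w ω ≤ 1) (hE : Measurable[m] E) (hE0 : ∀ ω, 0 ≤ E ω) {c : ℝ}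
    (hEc : ∀ ω, E ω ≤ c) :
    ∫ ω, E ω * Real.exp (lam * (w ω * deviation lam (κ (z ω)) f (y ω))) ∂μ ≤ ∫ ω, E ω ∂μ := by
  have hf2 := abs_sq_le_of_abs_le hb
  let p : Ω → ℝ := fun ω => ∫ v, f v ∂(κ (z ω))
  let q : Ω → ℝ := fun ω => ∫ v, f v ^ 2 ∂(κ (z ω))
  have hp : Measurable[m] p :=
    (hf.stronglyMeasurable.integral_kernel.comp_measurable hz).measurable
  have hq : Measurable[m] q :=
    ((hf.pow_const 2).stronglyMeasurable.integral_kernel.comp_measurable hz).measurable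
  have hpb : ∀ ω, |p ω| ≤ 2 * H := fun ω => abs_integral_le hb
  have hV0 : ∀ ω, 0 ≤ varOf (κ (z ω)) f := fun ω => varOf_nonneg hf hb
  have hVq : ∀ ω, varOf (κ (z ω)) f = q ω - p ω ^ 2 := fun ω => rfl
  let U : Ω → ℝ := fun ω => E ω * Real.exp (-(lam ^ 2 * w ω * (q ω - p ω ^ 2)))
  have hUm : Measurable[m] U :=
    hE.mul (((hw.const_mul _).mul (hq.sub (hp.pow_const 2))).neg.exp)
  have hU0 : ∀ ω, 0 ≤ U ω := fun ω => mul_nonneg (hE0 ω) (Real.exp_pos _).le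
  have hUE : ∀ ω, U ω ≤ E ω := fun ω => by
    refine mul_le_of_le_one_right (hE0 ω) (Real.exp_le_one_iff.2 ?_)
    rw [← hVq]
    exact neg_nonpos.2 (mul_nonneg (mul_nonneg (sq_nonneg _) (hw0 ω)) (hV0 ω))
  have hc0 : ∀ ω, |U ω| ≤ c := fun ω => by
    rw [abs_of_nonneg (hU0 ω)]; exact (hUE ω).trans (hEc ω)
  have hcnn : 0 ≤ c := by
    obtain ⟨ω⟩ : Nonempty Ω := nonempty_of_isProbabilityMeasure μ
    exact (hE0 ω).trans (hEc ω)
  -- the coefficients of the quadratic bound of the exponential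
  let a₀ : Ω → ℝ := fun ω => U ω * (1 - lam * w ω * p ω + lam ^ 2 * w ω ^ 2 * p ω ^ 2)
  let a₁ : Ω → ℝ := fun ω => U ω * (lam * w ω - 2 * lam ^ 2 * w ω ^ 2 * p ω)
  let a₂ : Ω → ℝ := fun ω => U ω * (lam ^ 2 * w ω ^ 2)
  have ha₀ : Measurable[m] a₀ := hUm.mul ((measurable_const.sub ((hw.const_mul lam).mul hp)).add
    (((hw.pow_const 2).const_mul _).mul (hp.pow_const 2)))
  have ha₁ : Measurable[m] a₁ := hUm.mul ((hw.const_mul lam).sub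
    (((hw.pow_const 2).const_mul _).mul hp))
  have ha₂ : Measurable[m] a₂ := hUm.mul ((hw.pow_const 2).const_mul _)
  have hwb : ∀ ω, |w ω| ≤ 1 := fun ω => by rw [abs_of_nonneg (hw0 ω)]; exact hw1 ω
  have hlw : ∀ ω, |lam * w ω| ≤ lam := fun ω => by
    rw [abs_mul, abs_of_nonneg hlam0]; exact mul_le_of_le_one_right hlam0 (hwb ω)
  have hlw2 : ∀ ω, |lam ^ 2 * w ω ^ 2| ≤ lam ^ 2 := fun ω => by
    rw [← mul_pow, abs_pow]; exact pow_le_pow_left₀ (abs_nonneg _) (hlw ω) 2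
  have hb₀ : ∀ ω, |a₀ ω| ≤ c * (1 + lam * (2 * H) + lam ^ 2 * (2 * H) ^ 2) := fun ω => by
    rw [abs_mul]
    refine mul_le_mul (hc0 ω) ?_ (abs_nonneg _) hcnn
    refine (abs_add_le _ _).trans (add_le_add ((abs_sub _ _).trans (add_le_add (by simp) ?_)) ?_)
    · rw [abs_mul]; exact mul_le_mul (hlw ω) (hpb ω) (abs_nonneg _) hlam0
    · rw [abs_mul]
      refine mul_le_mul (hlw2 ω) ?_ (abs_nonneg _) (sq_nonneg _)
      rw [abs_pow]; exact pow_le_pow_left₀ (abs_nonneg _) (hpb ω) 2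
  have hb₁ : ∀ ω, |a₁ ω| ≤ c * (lam + 2 * (lam ^ 2 * (2 * H))) := fun ω => by
    rw [abs_mul]
    refine mul_le_mul (hc0 ω) ?_ (abs_nonneg _) hcnn
    refine (abs_sub _ _).trans (add_le_add (hlw ω) ?_)
    have : 2 * lam ^ 2 * w ω ^ 2 * p ω = 2 * (lam ^ 2 * w ω ^ 2 * p ω) := by ring
    rw [this, abs_mul, abs_two, abs_mul]
    exact mul_le_mul_of_nonneg_left
      (mul_le_mul (hlw2 ω) (hpb ω) (abs_nonneg _) (sq_nonneg _)) two_pos.le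
  have hb₂ : ∀ ω, |a₂ ω| ≤ c * lam ^ 2 := fun ω => by
    rw [abs_mul]
    exact mul_le_mul (hc0 ω) (hlw2 ω) (abs_nonneg _) hcnn
  have hfm : Measurable fun ω => f (y ω) := hf.comp hy
  have hfb : ∀ ω, |f (y ω)| ≤ 2 * H := fun ω => hb _
  have hI : ∀ {u v : Ω → ℝ} {s t : ℝ}, Measurable[m] u → (∀ ω, |u ω| ≤ s) → Measurable v →
      (∀ ω, |v ω| ≤ t) → Integrable (fun ω => u ω * v ω) μ := fun hu hus hv hvt =>
    (integrable_of_abs_le hv hvt).bdd_mul (hu.mono hm le_rfl).aestronglyMeasurable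
      (.of_forall hus)
  have hi₀ : Integrable a₀ μ := integrable_of_abs_le (ha₀.mono hm le_rfl) hb₀
  have hi₁ := hI ha₁ hb₁ hfm hfb
  have hi₂ := hI ha₂ hb₂ (hfm.pow_const 2) fun ω => hf2 (y ω)
  have hj₁ := hI ha₁ hb₁ (hp.mono hm le_rfl) hpb
  have hj₂ := hI ha₂ hb₂ (hq.mono hm le_rfl) fun ω => abs_integral_le hf2
  have hi : Integrable (fun ω => a₀ ω + a₁ ω * f (y ω)) μ := hi₀.add hi₁
  have hj : Integrable (fun ω => a₀ ω + a₁ ω * p ω) μ := hi₀.add hj₁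
  have hpt : ∀ ω, E ω * Real.exp (lam * (w ω * deviation lam (κ (z ω)) f (y ω))) ≤
      a₀ ω + a₁ ω * f (y ω) + a₂ ω * f (y ω) ^ 2 := fun ω => by
    set t := lam * w ω * (f (y ω) - p ω) with ht
    have ht1 : |t| ≤ 1 := by
      rw [ht, abs_mul]
      have h1 : |f (y ω) - p ω| ≤ 4 * H :=
        (abs_sub _ _).trans (by linarith [hb (y ω), hpb ω])
      calc _ ≤ lam * (4 * H) := mul_le_mul (hlw ω) h1 (abs_nonneg _) hlam0
        _ ≤ 1 := by linarith
    have h2 : Real.exp t ≤ 1 + t + t ^ 2 := by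
      linarith [(abs_le.1 (Real.abs_exp_sub_one_sub_id_le ht1)).2]
    have h3 : E ω * Real.exp (lam * (w ω * deviation lam (κ (z ω)) f (y ω))) =
        U ω * Real.exp t := by
      simp only [U]
      rw [mul_assoc, ← Real.exp_add, deviation, hVq, ht]
      congr 2
      simp only [p]
      ring
    rw [h3]
    refine (mul_le_mul_of_nonneg_left h2 (hU0 ω)).trans_eq ?_
    simp only [a₀, a₁, a₂, ht]
    ring
  -- After taking means the linear term vanishes and `1 + lam² w² V` remains. As `w² ≤ w`, it is at
  -- most `exp (lam² w V)`, the inverse of the factor contained in `U`.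
  have hpt' : ∀ ω, a₀ ω + a₁ ω * p ω + a₂ ω * q ω ≤ E ω := fun ω => by
    have h1 : a₀ ω + a₁ ω * p ω + a₂ ω * q ω =
        U ω * (1 + lam ^ 2 * w ω ^ 2 * (q ω - p ω ^ 2)) := by
      simp only [a₀, a₁, a₂]; ring
    have h2 : lam ^ 2 * w ω ^ 2 * (q ω - p ω ^ 2) ≤ lam ^ 2 * w ω * (q ω - p ω ^ 2) := by
      rw [← hVq]
      refine mul_le_mul_of_nonneg_right ?_ (hV0 ω)
      refine mul_le_mul_of_nonneg_left ?_ (sq_nonneg _)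
      rw [sq]; exact mul_le_of_le_one_left (hw0 ω) (hw1 ω)
    have h3 := Real.add_one_le_exp (lam ^ 2 * w ω * (q ω - p ω ^ 2))
    rw [h1]
    calc _ ≤ U ω * Real.exp (lam ^ 2 * w ω * (q ω - p ω ^ 2)) :=
          mul_le_mul_of_nonneg_left (by linarith) (hU0 ω)
      _ = E ω := by
          simp only [U]
          rw [mul_assoc, ← Real.exp_add, neg_add_cancel, Real.exp_zero, mul_one]
  calc _ ≤ ∫ ω, (a₀ ω + a₁ ω * f (y ω) + a₂ ω * f (y ω) ^ 2) ∂μ :=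
        integral_mono_of_nonneg (.of_forall fun ω => mul_nonneg (hE0 ω) (Real.exp_pos _).le)
          (hi.add hi₂) (.of_forall hpt)
    _ = ∫ ω, (a₀ ω + a₁ ω * p ω + a₂ ω * q ω) ∂μ := by
        rw [integral_add hi hi₂, integral_add hi₀ hi₁,
          integral_add hj hj₂, integral_add hi₀ hj₁,
          integral_mul_comp_eq hm hz hy hlaw hf hb ha₁ hb₁,
          integral_mul_comp_eq hm hz hy hlaw (hf.pow_const 2) hf2 ha₂ hb₂]
    _ ≤ ∫ ω, E ω ∂μ := integral_mono (hj.add hj₂)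
        (integrable_of_abs_le (B := c) (hE.mono hm le_rfl) fun ω => by
          rw [abs_of_nonneg (hE0 ω)]; exact hEc ω) hpt'

/-- The exponential of the weighted sum of the compensated deviations has mean at most `1`. -/
theorem integral_exp_sum_deviation_le {k : ℕ} (hk : 1 ≤ k) {𝓕 : ℕ → MeasurableSpace Ω}
    (h𝓕 : ∀ s, 𝓕 s ≤ mΩ) (h𝓕mono : Monotone 𝓕) {κ : ℕ → Kernel Z Y}
    [∀ s, IsMarkovKernel (κ s)] {z : ℕ → Ω → Z} {y : ℕ → Ω → Y} {w : ℕ → Ω → ℝ}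
    (hz : ∀ s ∈ Finset.Ico 1 k, Measurable[𝓕 s] (z s))
    (hy : ∀ s ∈ Finset.Ico 1 k, Measurable[𝓕 (s + 1)] (y s))
    (hw : ∀ s ∈ Finset.Ico 1 k, Measurable[𝓕 s] (w s))
    (hlaw : ∀ s ∈ Finset.Ico 1 k, ∀ B : Set Y, MeasurableSet B →
      μ⟦y s ⁻¹' B | 𝓕 s⟧ =ᵐ[μ] fun ω => (κ s (z s ω)).real B)
    (hw0 : ∀ s ω, 0 ≤ w s ω) (hw1 : ∀ s ω, w s ω ≤ 1) {f : Y → ℝ} {H lam : ℝ} (hH : 0 ≤ H)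
    (hlam0 : 0 ≤ lam) (hlam : 4 * H * lam ≤ 1) (hf : Measurable f)
    (hb : ∀ v, |f v| ≤ 2 * H) :
    (Measurable[𝓕 k] fun ω =>
      ∑ s ∈ Finset.Ico 1 k, w s ω * deviation lam (κ s (z s ω)) f (y s ω)) ∧
    (∀ ω, |∑ s ∈ Finset.Ico 1 k, w s ω * deviation lam (κ s (z s ω)) f (y s ω)| ≤ k * (4 * H)) ∧
    ∫ ω, Real.exp (lam * ∑ s ∈ Finset.Ico 1 k, w s ω * deviation lam (κ s (z s ω)) f (y s ω)) ∂μ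
      ≤ 1 := by
  -- Measurability and boundedness are carried along because the exponential at stage `k` serves as
  -- the factor `E` of the next step.
  induction k, hk using Nat.le_induction with
  | base => simp [hH]
  | succ k hk ih =>
    have hsub : ∀ s ∈ Finset.Ico 1 k, s ∈ Finset.Ico 1 (k + 1) := fun s hs => by
      simp only [Finset.mem_Ico] at hs ⊢; omega
    have hkm : k ∈ Finset.Ico 1 (k + 1) := by simp [hk]
    obtain ⟨hmeas, hbd, hint⟩ := ih (fun s hs => hz s (hsub s hs)) (fun s hs => hy s (hsub s hs))
      (fun s hs => hw s (hsub s hs)) (fun s hs => hlaw s (hsub s hs))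
    have hle : 𝓕 k ≤ 𝓕 (k + 1) := h𝓕mono (Nat.le_succ k)
    simp only [Finset.sum_Ico_succ_top hk]
    refine ⟨?_, fun ω => ?_, ?_⟩
    · refine (hmeas.mono hle le_rfl).add (((hw k hkm).mono hle le_rfl).mul ?_)
      exact @measurable_deviation Ω Y (𝓕 (k + 1)) _ Z _ (κ k) _ _
        ((hz k hkm).mono hle le_rfl) (hy k hkm) f hf lam
    · refine (abs_add_le _ _).trans ?_
      rw [Nat.cast_add, add_mul, Nat.cast_one]
      refine add_le_add (hbd ω) ?_
      rw [abs_mul, abs_of_nonneg (hw0 k ω)]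
      exact mul_le_mul (hw1 k ω) (abs_deviation_le hlam0 hlam hf hb _) (abs_nonneg _) one_pos.le
    · simp only [mul_add, Real.exp_add]
      refine (integral_mul_exp_deviation_le (h𝓕 k) (hz k hkm)
        ((hy k hkm).mono (h𝓕 (k + 1)) le_rfl) (hlaw k hkm) hlam0 hlam hf hb (hw k hkm)
        (hw0 k) (hw1 k) (hmeas.const_mul lam).exp (fun ω => (Real.exp_pos _).le)
        (c := Real.exp (lam * (k * (4 * H)))) fun ω => ?_).trans hint
      exact Real.exp_le_exp.2 (mul_le_mul_of_nonneg_left ((le_abs_self _).trans (hbd ω)) hlam0)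

theorem measureReal_le_of_integral_exp_le {S : Ω → ℝ} (hS : Measurable S) {b lam : ℝ}
    (hb : ∀ ω, |S ω| ≤ b) (hlam : 0 < lam) (h : ∫ ω, Real.exp (lam * S ω) ∂μ ≤ 1) (t : ℝ) :
    μ.real {ω | t / lam ≤ S ω} ≤ Real.exp (-t) := by
  have hint : Integrable (fun ω => Real.exp (lam * S ω)) μ := by
    refine integrable_of_abs_le (B := Real.exp (lam * b)) (hS.const_mul lam).exp fun ω => ?_
    rw [Real.abs_exp]
    exact Real.exp_le_exp.2 (mul_le_mul_of_nonneg_left ((le_abs_self _).trans (hb ω)) hlam.le)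
  refine (measure_ge_le_exp_mul_mgf (t / lam) hlam.le hint).trans ?_
  rw [neg_mul, mul_div_cancel₀ _ hlam.ne']
  exact mul_le_of_le_one_right (Real.exp_pos _).le h

end Supermartingale

/-! ### Concentration along the interaction, at a fixed point and function. -/

section Concentration

variable {Ω X A : Type*} [mΩ : MeasurableSpace Ω] [MeasurableSpace X] [MeasurableSpace A]
  [MetricSpace (X × A)]

/-- The weighted sum of the compensated deviations of `f` along a trajectory. -/
noncomputable def deviationSum (P : ℕ → ℕ → Kernel (X × A) X) (Γ : ℕ → ℝ → ℝ) (σ lam : ℝ)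
    (x : ℕ → ℕ → X) (a : ℕ → ℕ → A) (k h : ℕ) (f : X → ℝ) (z : X × A) : ℝ :=
  ∑ s ∈ Finset.Ico 1 k,
    weight Γ σ x a k h s z * deviation lam (P s h (x s h, a s h)) f (x s (h + 1))

variable {μ : Measure Ω} [IsProbabilityMeasure μ] {P : ℕ → ℕ → Kernel (X × A) X}
  [∀ k h, IsMarkovKernel (P k h)] {K H : ℕ} {F : Filtration (ℕ ×ₗ ℕ) mΩ}
  {x : ℕ → ℕ → Ω → X} {a : ℕ → ℕ → Ω → A} {Γ : ℕ → ℝ → ℝ} {C₁ C₂ C₃ η : ℝ} {W : ℕ}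

/-- The kernel is controlled only for nonnegative distances; truncating its argument gives a
continuous function on the whole line, hence measurable weights. -/
theorem IsBaseKernel.continuous_comp_max (hΓ : IsBaseKernel Γ C₁ C₂ C₃ η W) (hC₂ : 0 ≤ C₂)
    (t : ℕ) : Continuous fun v => Γ t (max v 0) := by
  refine (LipschitzWith.of_dist_le_mul (K := C₂.toNNReal) fun u v => ?_).continuous
  rw [Real.coe_toNNReal _ hC₂, Real.dist_eq, Real.dist_eq]
  exact (hΓ.lipschitz _ _ _ (le_max_right _ _) (le_max_right _ _)).trans
    (mul_le_mul_of_nonneg_left (abs_max_sub_max_le_abs _ _ _) hC₂)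

theorem deviationSum_concentration [OpensMeasurableSpace (X × A)]
    (hI : IsInteraction μ P K H F x a)
    (hΓ : IsBaseKernel Γ C₁ C₂ C₃ η W) (hC₂ : 0 ≤ C₂) {σ lam : ℝ} (hσ : 0 < σ) (hlam0 : 0 < lam)
    (hlam : 4 * H * lam ≤ 1) {k h : ℕ} (hk : k ∈ Finset.Icc 1 K) (hh : h ∈ Finset.Icc 1 H)
    {f : X → ℝ} (hf : Measurable f) (hb : ∀ v, |f v| ≤ 2 * H) (z : X × A) (t : ℝ) :
    MeasurableSet {ω | t / lam ≤ deviationSum P Γ σ lam (fun s j => x s j ω)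
      (fun s j => a s j ω) k h f z} ∧
    μ.real {ω | t / lam ≤ deviationSum P Γ σ lam (fun s j => x s j ω)
      (fun s j => a s j ω) k h f z} ≤ Real.exp (-t) := by
  rw [Finset.mem_Icc] at hk hh
  have hK : ∀ s ∈ Finset.Ico 1 k, s ∈ Finset.Icc 1 K := fun s hs => by
    simp only [Finset.mem_Ico, Finset.mem_Icc] at hs ⊢; omega
  have hhH : h ∈ Finset.Icc 1 H := Finset.mem_Icc.2 hh
  have hh1 : h ∈ Finset.Icc 1 (H + 1) := by simp only [Finset.mem_Icc]; omega
  have hh2 : h + 1 ∈ Finset.Icc 1 (H + 1) := by simp only [Finset.mem_Icc]; omega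
  have hz : ∀ s ∈ Finset.Ico 1 k, Measurable[F (toLex (s, h))] fun ω => (x s h ω, a s h ω) :=
    fun s hs => (hI.state_adapted s (hK s hs) h hh1).prodMk
      (hI.action_adapted s (hK s hs) h hhH)
  -- With `h` fixed, time runs over episodes. The next state `x s (h + 1)` is known at `(s, h + 1)`,
  -- which lexicographically precedes `(s + 1, h)`.
  have hmono : Monotone fun s : ℕ => F (toLex (s, h)) := fun s t hst =>
    F.mono (Prod.Lex.toLex_le_toLex.2 (hst.lt_or_eq.imp id fun h => ⟨h, le_rfl⟩))
  have key := integral_exp_sum_deviation_le (μ := μ) hk.1 (𝓕 := fun s => F (toLex (s, h)))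
    (fun s => F.le _) hmono (κ := fun s => P s h) (z := fun s ω => (x s h ω, a s h ω))
    (y := fun s => x s (h + 1))
    (w := fun s ω => weight Γ σ (fun s j => x s j ω) (fun s j => a s j ω) k h s z) hz
    (fun s hs => (hI.state_adapted s (hK s hs) (h + 1) hh2).mono
      (F.mono (Prod.Lex.toLex_le_toLex.2 (Or.inl (Nat.lt_succ_self s)))) le_rfl)
    (fun s hs => ?_) (fun s hs B hB => hI.transition s (hK s hs) h hhH B hB)
    (fun s ω => weight_nonneg _ _ k h z hΓ hσ s) (fun s ω => weight_le_one _ _ k h z hΓ hσ s)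
    (Nat.cast_nonneg H) hlam0.le hlam hf hb
  · have hmeas := key.1.mono (F.le _) le_rfl
    exact ⟨measurableSet_le measurable_const hmeas,
      measureReal_le_of_integral_exp_le hmeas key.2.1 hlam0 key.2.2 t⟩
  · have h1 : Measurable fun u : X × A => Γ (k - s - 1) (max (dist z u / σ) 0) :=
      ((hΓ.continuous_comp_max hC₂ _).comp
        ((continuous_const.dist continuous_id).div_const σ)).measurable
    have h2 : (fun ω => weight Γ σ (fun s j => x s j ω) (fun s j => a s j ω) k h s z) =
        (fun u : X × A => Γ (k - s - 1) (max (dist z u / σ) 0)) ∘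
          fun ω => (x s h ω, a s h ω) := by
      funext ω
      rw [Function.comp_apply, max_eq_left (by positivity)]
      rfl
    rw [h2]
    exact h1.comp (hz s hs)

end Concentration

/-! ### Moving the evaluation point to the net. -/

section Perturbation

variable {X A : Type*} [MeasurableSpace X] [MeasurableSpace A] [MetricSpace (X × A)]
  {P : ℕ → ℕ → Kernel (X × A) X} [∀ k h, IsMarkovKernel (P k h)] {K H : ℕ}
  {Γ : ℕ → ℝ → ℝ} {C₁ C₂ C₃ η : ℝ} {W : ℕ}

/-- The deviations are centred at the visited pairs, so `z` enters only through the weights. Leaving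
the sum unnormalized spares any comparison of counts. -/
theorem deviationSum_le_of_dist_le (hΓ : IsBaseKernel Γ C₁ C₂ C₃ η W) (hC₂ : 0 ≤ C₂)
    {x : ℕ → ℕ → X} {a : ℕ → ℕ → A}
    {σ lam ε : ℝ} (hσ : 0 < σ) (hlam0 : 0 ≤ lam) (hlam : 4 * H * lam ≤ 1) {f : X → ℝ}
    (hf : Measurable f) (hb : ∀ v, |f v| ≤ 2 * H) {k h : ℕ} {z z' : X × A} (hkK : k ≤ K)
    (hzz' : dist z z' ≤ ε) :
    deviationSum P Γ σ lam x a k h f z ≤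
      deviationSum P Γ σ lam x a k h f z' + K * (C₂ * (ε / σ) * (4 * H)) := by
  have hε : 0 ≤ ε := dist_nonneg.trans hzz'
  have h1 : ∀ s ∈ Finset.Ico 1 k,
      weight Γ σ x a k h s z * deviation lam (P s h (x s h, a s h)) f (x s (h + 1)) ≤
        weight Γ σ x a k h s z' * deviation lam (P s h (x s h, a s h)) f (x s (h + 1))
          + C₂ * (ε / σ) * (4 * H) := fun s _ => by
    rw [← sub_le_iff_le_add', ← sub_mul]
    refine (le_abs_self _).trans ?_
    rw [abs_mul]
    refine mul_le_mul ((abs_weight_sub_weight_le x a k h z hΓ hC₂ hσ s z').trans ?_)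
      (abs_deviation_le hlam0 hlam hf hb _) (abs_nonneg _) (by positivity)
    gcongr
  refine (Finset.sum_le_sum h1).trans ?_
  rw [Finset.sum_add_distrib, Finset.sum_const, Nat.card_Ico, nsmul_eq_mul]
  have h2 : ((k - 1 : ℕ) : ℝ) ≤ K := by exact_mod_cast (Nat.sub_le _ _).trans hkK
  rw [deviationSum]
  gcongr

end Perturbation

/-! ### Oddness in `f`. -/

section Negation

theorem estP_neg {X A : Type*} [MetricSpace (X × A)] (Γ : ℕ → ℝ → ℝ) (σ β : ℝ)
    (x : ℕ → ℕ → X) (a : ℕ → ℕ → A) (k h : ℕ) (f : X → ℝ) (z : X × A) :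
    estP Γ σ β x a k h (fun y => -f y) z = -estP Γ σ β x a k h f z := by
  simp [estP]

theorem avP_neg {X A : Type*} [MetricSpace (X × A)] [MeasurableSpace X] [MeasurableSpace A]
    (P : ℕ → ℕ → Kernel (X × A) X) (Γ : ℕ → ℝ → ℝ) (σ β : ℝ) (x : ℕ → ℕ → X)
    (a : ℕ → ℕ → A) (k h : ℕ) (f : X → ℝ) (z : X × A) :
    avP P Γ σ β x a k h (fun y => -f y) z = -avP P Γ σ β x a k h f z := by
  simp only [avP, integral_neg, mul_neg, Finset.sum_neg_distrib]
  ring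

end Negation

/-! ### Deterministic decomposition of the error. -/

section Deterministic

variable {X A : Type*} [Nonempty X] [MetricSpace X] [MeasurableSpace X] [OpensMeasurableSpace X]
  [MeasurableSpace A] [MetricSpace (X × A)]
  {P : ℕ → ℕ → Kernel (X × A) X} [∀ k h, IsMarkovKernel (P k h)] {K H : ℕ}
  {x : ℕ → ℕ → X} {a : ℕ → ℕ → A} {Γ : ℕ → ℝ → ℝ} {C₁ C₂ C₃ η : ℝ} {W : ℕ}

/-- The error at one past visit, in terms of the deviation of a nearby function. -/
theorem sub_integral_le_deviation {D : ℝ} (hD : ∀ u v : X, dist u v ≤ D) (hH : 1 ≤ H)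
    {LQ Lp r d : ℝ} (hLQ : 0 < LQ) {ν ν' : Measure X} [IsProbabilityMeasure ν]
    [IsProbabilityMeasure ν'] (hW : wass ν' ν ≤ Lp * d) (hr : 0 ≤ r) (hd : 0 ≤ Lp * d)
    {f g : X → ℝ} (hf : f ∈ boundedLipschitz X (2 * LQ) (2 * H))
    (hg : g ∈ boundedLipschitz X (2 * LQ) (2 * H)) (hfg : ∀ v, |f v - g v| ≤ r) (v : X) :
    f v - ∫ u, f u ∂ν ≤ deviation (1 / (4 * H ^ 2)) ν' g v + 5 / 2 * r
      + 1 / (2 * H) * ∫ u, |f u| ∂ν + 3 * (LQ * (Lp * d)) := by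
  have hH' : (1 : ℝ) ≤ H := by exact_mod_cast hH
  have hfm := measurable_of_mem_boundedLipschitz hf
  have hgm := measurable_of_mem_boundedLipschitz hg
  have hfi := integrable_of_abs_le (μ := ν') hfm hf.2
  have hgi := integrable_of_abs_le (μ := ν') hgm hg.2
  have h1 : ∫ u, g u ∂ν' ≤ (∫ u, f u ∂ν') + r := by
    have : ∫ u, g u ∂ν' ≤ ∫ u, (f u + r) ∂ν' :=
      integral_mono hgi (hfi.add (integrable_const r)) fun u => by
        have := (abs_le.1 (hfg u)).1
        simp only; linarith
    rwa [integral_add hfi (integrable_const r), integral_const, probReal_univ, one_smul] at this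
  have h2 : ∫ u, |g u| ∂ν' ≤ (∫ u, |f u| ∂ν') + r := by
    have : ∫ u, |g u| ∂ν' ≤ ∫ u, (|f u| + r) ∂ν' :=
      integral_mono hgi.abs (hfi.abs.add (integrable_const r)) fun u => by
        have h3 := hfg u
        have h4 := abs_sub_abs_le_abs_sub (g u) (f u)
        rw [abs_sub_comm] at h4
        simp only; linarith
    rwa [integral_add hfi.abs (integrable_const r), integral_const, probReal_univ,
      one_smul] at this
  have hWL : 2 * LQ * wass ν' ν ≤ 2 * LQ * (Lp * d) := by gcongr
  have h3 : ∫ u, f u ∂ν' ≤ (∫ u, f u ∂ν) + 2 * LQ * (Lp * d) := by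
    linarith [integral_sub_integral_le_mul_wass hD ν' ν (by positivity : 0 < 2 * LQ) hf.1]
  have h4 : ∫ u, |f u| ∂ν' ≤ (∫ u, |f u| ∂ν) + 2 * LQ * (Lp * d) := by
    linarith [integral_sub_integral_le_mul_wass hD ν' ν (by positivity : 0 < 2 * LQ)
      (abs_mem_boundedLipschitz hf).1]
  -- The compensation is paid back here. Besides the mean of `|f|` it adds `r / 2` to the cost `2 *
  -- r` of the net, and one `LQ * (Lp * d)` to the two coming from the mean of `f`.
  have h5 : 1 / (4 * (H : ℝ) ^ 2) * varOf ν' g ≤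
      1 / (2 * H) * (∫ u, |f u| ∂ν) + LQ * (Lp * d) + 1 / 2 * r := by
    calc _ ≤ 1 / (4 * (H : ℝ) ^ 2) * (2 * H * ∫ u, |g u| ∂ν') := by
          gcongr; exact varOf_le hgm hg.2
      _ = 1 / (2 * H) * ∫ u, |g u| ∂ν' := by field_simp; norm_num
      _ ≤ 1 / (2 * H) * ((∫ u, |f u| ∂ν) + 2 * LQ * (Lp * d) + r) := by
          gcongr; linarith
      _ = 1 / (2 * H) * (∫ u, |f u| ∂ν) + 1 / (2 * H) * (2 * (LQ * (Lp * d)) + r) := by ring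
      _ ≤ 1 / (2 * H) * (∫ u, |f u| ∂ν) + 1 / 2 * (2 * (LQ * (Lp * d)) + r) := by
          have : 1 / (2 * (H : ℝ)) ≤ 1 / 2 := by
            apply one_div_le_one_div_of_le <;> linarith
          have : 0 ≤ LQ * (Lp * d) := by positivity
          gcongr
      _ = _ := by ring
  have h6 := (abs_le.1 (hfg v)).2
  rw [deviation]
  linarith

theorem estP_sub_avP_le {D : ℝ} (hD : ∀ u v : X, dist u v ≤ D) (hH : 1 ≤ H)
    (hΓ : IsBaseKernel Γ C₁ C₂ C₃ η W) (hC₁ : 0 < C₁) (hC₃ : 0 ≤ C₃) (hη₀ : 0 < η)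
    (hη₁ : η < 1) {σ β LQ Lp r : ℝ} (hσ : 0 < σ) (hβ : 0 < β) (hLQ : 0 < LQ) (hLp : 0 ≤ Lp)
    (hr : 0 ≤ r) {k h : ℕ} (hk : 1 ≤ k) (z : X × A)
    (hP : ∀ s ∈ Finset.Ico 1 k, ∀ z z' : X × A, wass (P s h z) (P s h z') ≤ Lp * dist z z')
    {f g : X → ℝ} (hf : f ∈ boundedLipschitz X (2 * LQ) (2 * H))
    (hg : g ∈ boundedLipschitz X (2 * LQ) (2 * H)) (hfg : ∀ v, |f v - g v| ≤ r) :
    estP Γ σ β x a k h f z - avP P Γ σ β x a k h f z ≤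
      deviationSum P Γ σ (1 / (4 * H ^ 2)) x a k h g z / count Γ σ β x a k h z + 5 / 2 * r
        + 1 / (2 * H) * ((∫ y, |f y| ∂(P k h z)) + 2 * biasP P H W LQ β C₃ η k h)
        + 6 * Lp * LQ * σ * (1 + √(Real.posLog (C₁ * k / β)))
        + 2 * β * H / count Γ σ β x a k h z := by
  have hc := hβ.trans_le (le_count (β := β) x a k h z hΓ hσ)
  set C := count Γ σ β x a k h z with hC
  have h1 : ∀ s ∈ Finset.Ico 1 k,
      normWeight Γ σ β x a k h s z * f (x s (h + 1))
          - normWeight Γ σ β x a k h s z * ∫ y, f y ∂(P s h z) ≤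
        weight Γ σ x a k h s z
            * deviation (1 / (4 * H ^ 2)) (P s h (x s h, a s h)) g (x s (h + 1)) / C
          + normWeight Γ σ β x a k h s z * (5 / 2 * r)
          + 1 / (2 * H) * (normWeight Γ σ β x a k h s z * ∫ y, |f y| ∂(P s h z))
          + 3 * Lp * LQ * (normWeight Γ σ β x a k h s z * dist z (x s h, a s h)) := by
    intro s hs
    have hn := normWeight_nonneg (β := β) x a k h z hΓ hσ hβ s
    have h2 := sub_integral_le_deviation hD hH hLQ (hP s hs (x s h, a s h) z) hr (by positivity)
      hf hg hfg (x s (h + 1))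
    rw [dist_comm] at h2
    have h3 := mul_le_mul_of_nonneg_left h2 hn
    have h4 : weight Γ σ x a k h s z
            * deviation (1 / (4 * H ^ 2)) (P s h (x s h, a s h)) g (x s (h + 1)) / C =
        normWeight Γ σ β x a k h s z
            * deviation (1 / (4 * H ^ 2)) (P s h (x s h, a s h)) g (x s (h + 1)) := by
      rw [normWeight, ← hC]; ring
    rw [h4]
    linarith
  have h2 := Finset.sum_le_sum h1
  rw [Finset.sum_sub_distrib, Finset.sum_add_distrib, Finset.sum_add_distrib,
    Finset.sum_add_distrib, ← Finset.sum_div, ← Finset.sum_mul, ← Finset.mul_sum,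
    ← Finset.mul_sum] at h2
  have h3 := mul_le_mul_of_nonneg_right (sum_normWeight_le_one (β := β) x a k h z hΓ hσ hβ)
    (by positivity : 0 ≤ 5 / 2 * r)
  have h4 := mul_le_mul_of_nonneg_left (sum_normWeight_mul_integral_le (P := P) hΓ hD hLQ hσ hβ
    hC₃ hη₀ hη₁ (abs_mem_boundedLipschitz hf) (fun _ => abs_nonneg _) x a k h z)
    (by positivity : 0 ≤ 1 / (2 * (H : ℝ)))
  have h5 := mul_le_mul_of_nonneg_left
    (sum_normWeight_mul_dist_le (β := β) x a k h z hΓ hC₁ hσ hβ hk)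
    (by positivity : 0 ≤ 3 * Lp * LQ)
  -- The regularization mass `β / C` occurs in `avP` but not in `estP`; it is bounded crudely.
  have h6 : -(β / C * ∫ y, f y ∂(P k h z)) ≤ 2 * β * H / C := by
    have h7 := (abs_le.1 (abs_integral_le (μ := P k h z) hf.2)).1
    have h8 := mul_le_mul_of_nonneg_left h7 (by positivity : 0 ≤ β / C)
    have h9 : 2 * β * H / C = β / C * (2 * H) := by ring
    rw [h9]
    linarith
  rw [estP, avP, deviationSum, ← hC]
  linarith

end Deterministic

/-! ### The logarithmic factor as a union-bound budget. -/

section SquareThree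

variable {X A : Type*} [Nonempty X] [Nonempty A] [MetricSpace X] [MetricSpace (X × A)]
  {d₁ d₂ LQ σ δ : ℝ} {H K : ℕ}

theorem square3_nonneg (hd₁ : HasCoveringDim (X × A) d₁) (hH : 1 ≤ H) (hK : 1 ≤ K)
    (hLQ : 0 < LQ) (hσ : 0 < σ) (h : LQ * σ ≤ 2 * H) (hδ₀ : 0 < δ) (hδ₁ : δ < 1) (k : ℕ) :
    0 ≤ square3 X A H K LQ σ d₂ k δ := by
  have hH' : (1 : ℝ) ≤ H := by exact_mod_cast hH
  have hK' : (1 : ℝ) ≤ K := by exact_mod_cast hK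
  have hN : (1 : ℝ) ≤ covNum (X × A) (σ ^ (2 + d₂) / (H ^ 2 * K)) := by
    exact_mod_cast hd₁.one_le_covNum (by positivity)
  refine Real.log_nonneg (one_le_mul_of_one_le_of_one_le (one_le_mul_of_one_le_of_one_le
    (one_le_mul_of_one_le_of_one_le ?_ (one_le_mul_of_one_le_of_one_le hK' hH')) hN)
    (one_le_pow₀ (one_le_two_mul_div hLQ hσ h)))
  rw [one_le_div hδ₀]
  have : (1 : ℝ) ≤ Real.exp 1 := Real.one_le_exp zero_le_one
  have : (0 : ℝ) ≤ k := Nat.cast_nonneg k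
  nlinarith

theorem exp_neg_square3_le (hd₁ : HasCoveringDim (X × A) d₁) (hH : 1 ≤ H) (hK : 1 ≤ K)
    (hLQ : 0 < LQ) (hσ : 0 < σ) (hδ₀ : 0 < δ) (k : ℕ) :
    Real.exp (-square3 X A H K LQ σ d₂ k δ) ≤
      δ / ((K * H) * covNum (X × A) (σ ^ (2 + d₂) / (H ^ 2 * K))
        * (2 * H / (LQ * σ)) ^ covNum X σ) := by
  have hH' : (1 : ℝ) ≤ H := by exact_mod_cast hH
  have hK' : (1 : ℝ) ≤ K := by exact_mod_cast hK
  have hN : (1 : ℝ) ≤ covNum (X × A) (σ ^ (2 + d₂) / (H ^ 2 * K)) := by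
    exact_mod_cast hd₁.one_le_covNum (by positivity)
  set M := (K * H) * (covNum (X × A) (σ ^ (2 + d₂) / (H ^ 2 * K)) : ℝ)
        * (2 * H / (LQ * σ)) ^ covNum X σ with hM
  have hM0 : 0 < M := by positivity
  have he : 1 ≤ 4 * Real.exp 1 * (2 * k + 1) := by
    have : (1 : ℝ) ≤ Real.exp 1 := Real.one_le_exp zero_le_one
    have : (0 : ℝ) ≤ k := Nat.cast_nonneg k
    nlinarith
  have hs : square3 X A H K LQ σ d₂ k δ = Real.log (4 * Real.exp 1 * (2 * k + 1) / δ * M) := by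
    rw [square3, hM]; congr 1; ring
  rw [hs, Real.exp_neg, Real.exp_log (by positivity), ← one_div,
    div_le_div_iff₀ (by positivity) hM0]
  have : δ * (4 * Real.exp 1 * (2 * k + 1) / δ * M) = 4 * Real.exp 1 * (2 * k + 1) * M := by
    field_simp
  rw [this]
  gcongr

end SquareThree

/-! ### The good event and the confidence bound. -/

section ConfidenceBound

variable {Ω X A : Type*} [mΩ : MeasurableSpace Ω]
  [Nonempty X] [MetricSpace X] [MeasurableSpace X] [Nonempty A] [MeasurableSpace A]
  [MetricSpace (X × A)] [OpensMeasurableSpace (X × A)]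
  {μ : Measure Ω} [IsProbabilityMeasure μ] {d₁ d₂ : ℝ} {K H : ℕ}
  {Γ : ℕ → ℝ → ℝ} {C₁ C₂ C₃ η : ℝ} {W : ℕ}
  {β Lp LQ σ δ : ℝ} {P : ℕ → ℕ → Kernel (X × A) X} [∀ k h, IsMarkovKernel (P k h)]
  {F : Filtration (ℕ ×ₗ ℕ) mΩ} {x : ℕ → ℕ → Ω → X} {a : ℕ → ℕ → Ω → A}

/-- Apart from a spare factor at least 1, the argument of the logarithm in `square3` is `1/δ` times
a bound on the number of index tuples, so each bad event has probability at most `δ / M`. -/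
theorem exists_event_deviationSum_le (hd₁ : HasCoveringDim (X × A) d₁) (hH : 1 ≤ H)
    (hK : 1 ≤ K) (hC₂ : 0 ≤ C₂) (hΓ : IsBaseKernel Γ C₁ C₂ C₃ η W)
    (hI : IsInteraction μ P K H F x a) (hLQ : 0 < LQ) (hσ : 0 < σ) (hδ₀ : 0 < δ)
    (CZ : Finset (X × A)) (hCZ : CZ.card = covNum (X × A) (σ ^ (2 + d₂) / (H ^ 2 * K)))
    (N : Finset (X → ℝ)) (hN : (N.card : ℝ) ≤ (2 * H / (LQ * σ)) ^ covNum X σ)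
    (hNm : ∀ g ∈ N, Measurable g) (hNb : ∀ g ∈ N, ∀ v, |g v| ≤ 2 * H) :
    ∃ G : Set Ω, MeasurableSet G ∧ 1 - δ ≤ μ.real G ∧
      ∀ ω ∈ G, ∀ k ∈ Finset.Icc 1 K, ∀ h ∈ Finset.Icc 1 H, ∀ z ∈ CZ, ∀ g ∈ N,
        deviationSum P Γ σ (1 / (4 * H ^ 2)) (fun s j => x s j ω) (fun s j => a s j ω) k h g z ≤
          4 * H ^ 2 * square3 X A H K LQ σ d₂ k δ := by
  have hH' : (1 : ℝ) ≤ H := by exact_mod_cast hH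
  have hK' : (1 : ℝ) ≤ K := by exact_mod_cast hK
  let lam : ℝ := 1 / (4 * H ^ 2)
  have hlam0 : 0 < lam := by positivity
  have hlam : 4 * H * lam ≤ 1 := by
    have : 4 * H * lam = 1 / H := by simp only [lam]; field_simp
    rw [this, div_le_one (by linarith)]
    exact hH'
  let I : Finset (ℕ × ℕ × (X × A) × (X → ℝ)) :=
    Finset.Icc 1 K ×ˢ Finset.Icc 1 H ×ˢ CZ ×ˢ N
  let bad : ℕ × ℕ × (X × A) × (X → ℝ) → Set Ω := fun i =>
    {ω | square3 X A H K LQ σ d₂ i.1 δ / lam ≤ deviationSum P Γ σ lam (fun s j => x s j ω)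
      (fun s j => a s j ω) i.1 i.2.1 i.2.2.2 i.2.2.1}
  have hI' : ∀ i ∈ I, MeasurableSet (bad i) ∧
      μ.real (bad i) ≤ Real.exp (-square3 X A H K LQ σ d₂ i.1 δ) := by
    rintro ⟨k, h, z, g⟩ hi
    simp only [I, Finset.mem_product] at hi
    exact deviationSum_concentration hI hΓ hC₂ hσ hlam0 hlam hi.1 hi.2.1 (hNm g hi.2.2.2)
      (hNb g hi.2.2.2) z _
  set M : ℝ := (K * H) * covNum (X × A) (σ ^ (2 + d₂) / (H ^ 2 * K))
        * (2 * H / (LQ * σ)) ^ covNum X σ with hM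
  have hcov : (1 : ℝ) ≤ covNum (X × A) (σ ^ (2 + d₂) / (H ^ 2 * K)) := by
    exact_mod_cast hd₁.one_le_covNum (by positivity)
  have hM0 : 0 < M := by positivity
  have hcard : (I.card : ℝ) ≤ M := by
    simp only [I, Finset.card_product, Nat.card_Icc, add_tsub_cancel_right, Nat.cast_mul, hCZ]
    rw [hM, ← mul_assoc, ← mul_assoc]
    gcongr
  have hmeas : MeasurableSet (⋃ i ∈ I, bad i) :=
    Finset.measurableSet_biUnion I fun i hi => (hI' i hi).1
  have hprob : μ.real (⋃ i ∈ I, bad i) ≤ δ := by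
    calc μ.real (⋃ i ∈ I, bad i) ≤ ∑ i ∈ I, μ.real (bad i) := measureReal_biUnion_finset_le _ _
      _ ≤ ∑ i ∈ I, δ / M := Finset.sum_le_sum fun i hi =>
          (hI' i hi).2.trans (exp_neg_square3_le hd₁ hH hK hLQ hσ hδ₀ _)
      _ = I.card * (δ / M) := by rw [Finset.sum_const, nsmul_eq_mul]
      _ ≤ M * (δ / M) := by gcongr
      _ = δ := mul_div_cancel₀ _ hM0.ne'
  refine ⟨(⋃ i ∈ I, bad i)ᶜ, hmeas.compl, ?_, fun ω hω k hk h hh z hz g hg => ?_⟩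
  · rw [probReal_compl_eq_one_sub hmeas]
    linarith
  · by_contra hcon
    refine hω (Set.mem_biUnion (x := (k, h, z, g)) ?_ ?_)
    · simp only [I, Finset.coe_product, Set.mem_prod, Finset.mem_coe]
      exact ⟨hk, hh, hz, hg⟩
    · simp only [bad, Set.mem_ofPred_eq]
      have : square3 X A H K LQ σ d₂ k δ / lam = 4 * H ^ 2 * square3 X A H K LQ σ d₂ k δ := by
        simp only [lam]; field_simp
      rw [this]
      exact (not_le.1 hcon).le

theorem confidence_bound [OpensMeasurableSpace X] (hd₁ : HasCoveringDim (X × A) d₁)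
    (hd₂ : HasCoveringDim X d₂) (hH : 1 ≤ H) (hC₁ : 0 < C₁) (hC₂ : 1 ≤ C₂) (hC₃ : 0 ≤ C₃)
    (hη₀ : 0 < η) (hη₁ : η < 1) (hΓ : IsBaseKernel Γ C₁ C₂ C₃ η W) (hβ : 0 < β) (hLp : 0 ≤ Lp)
    (hP : ∀ k ∈ Finset.Icc 1 K, ∀ h ∈ Finset.Icc 1 H, ∀ z z' : X × A,
      wass (P k h z) (P k h z') ≤ Lp * dist z z')
    (hI : IsInteraction μ P K H F x a) (hLQ : 0 < LQ) (hσ : 0 < σ) (hLQσ : LQ * σ ≤ 2 * H)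
    (hδ₀ : 0 < δ) (hδ₁ : δ < 1) :
    ∃ G : Set Ω, MeasurableSet G ∧ 1 - δ ≤ μ.real G ∧
      ∀ ω ∈ G, ∀ k ∈ Finset.Icc 1 K, ∀ h ∈ Finset.Icc 1 H, ∀ z : X × A,
        ∀ f ∈ boundedLipschitz X (2 * LQ) (2 * H),
          |estP Γ σ β (fun s j => x s j ω) (fun s j => a s j ω) k h f z
            - avP P Γ σ β (fun s j => x s j ω) (fun s j => a s j ω) k h f z|
          ≤ 1 / H * ∫ y, |f y| ∂(P k h z)
            + (14 * H ^ 2 * C₂ * square3 X A H K LQ σ d₂ k δ + 2 * β * H)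
              / count Γ σ β (fun s j => x s j ω) (fun s j => a s j ω) k h z
            + theta3 X A H K Lp LQ σ β C₂ d₂ k δ * σ ^ (1 + d₂)
            + theta4 Lp LQ β C₁ k * σ
            + 2 / H * biasP P H W LQ β C₃ η k h := by
  rcases Nat.eq_zero_or_pos K with rfl | hK
  · exact ⟨Set.univ, MeasurableSet.univ, by simpa using hδ₀.le, fun ω _ k hk => by simp at hk⟩
  have hH' : (1 : ℝ) ≤ H := by exact_mod_cast hH
  have hK' : (1 : ℝ) ≤ K := by exact_mod_cast hK
  obtain ⟨D, hD⟩ := hd₂.exists_dist_le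
  have hε : 0 < σ ^ (2 + d₂) / (H ^ 2 * K) := by positivity
  obtain ⟨CZ, hCZ, hcovZ⟩ := exists_finset_cover hε (hd₁.coveringNumber_ne_top hε)
  obtain ⟨N, hN, hNcard, hnet⟩ := exists_net_boundedLipschitz_of_covNum hd₂ hH hLQ hσ hLQσ
  obtain ⟨G, hG, hGδ, hGb⟩ := exists_event_deviationSum_le hd₁ hH hK (by linarith) hΓ hI hLQ hσ
    hδ₀ CZ hCZ N hNcard (fun g hg => measurable_of_mem_boundedLipschitz (hN g hg))
    fun g hg => (hN g hg).2
  refine ⟨G, hG, hGδ, fun ω hω k hk h hh z f hf => ?_⟩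
  have hkK := Finset.mem_Icc.1 hk
  have hc := le_count (β := β) (fun s j => x s j ω) (fun s j => a s j ω) k h z hΓ hσ
  have hsq : 0 ≤ square3 X A H K LQ σ d₂ k δ :=
    square3_nonneg hd₁ hH hK hLQ hσ hLQσ hδ₀ hδ₁ k
  have hbias : 0 ≤ biasP P H W LQ β C₃ η k h := biasP_nonneg hD hLQ hβ hC₃ hη₀ hη₁
  set Q := square3 X A H K LQ σ d₂ k δ with hQ
  set C := count Γ σ β (fun s j => x s j ω) (fun s j => a s j ω) k h z with hCdef
  have hc0 : 0 < C := hβ.trans_le hc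
  have hlam : 4 * (H : ℝ) * (1 / (4 * H ^ 2)) ≤ 1 := by
    have : 4 * (H : ℝ) * (1 / (4 * H ^ 2)) = 1 / H := by field_simp
    rw [this, div_le_one (by linarith)]
    exact hH'
  -- A one-sided bound suffices: applied to `f` and `-f`, which share the same right-hand side, it
  -- gives the absolute value on the same event.
  have main : ∀ u ∈ boundedLipschitz X (2 * LQ) (2 * H), (∀ y, |u y| = |f y|) →
      estP Γ σ β (fun s j => x s j ω) (fun s j => a s j ω) k h u z
        - avP P Γ σ β (fun s j => x s j ω) (fun s j => a s j ω) k h u z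
      ≤ 1 / H * ∫ y, |f y| ∂(P k h z) + (14 * H ^ 2 * C₂ * Q + 2 * β * H) / C
        + theta3 X A H K Lp LQ σ β C₂ d₂ k δ * σ ^ (1 + d₂)
        + theta4 Lp LQ β C₁ k * σ + 2 / H * biasP P H W LQ β C₃ η k h := by
    intro u hu huf
    obtain ⟨g, hg, hug⟩ := hnet u hu
    obtain ⟨z', hz', hzz'⟩ := hcovZ z
    have h1 := hGb ω hω k hk h hh z' hz' g hg
    have h2 := deviationSum_le_of_dist_le (P := P) (x := fun s j => x s j ω)
      (a := fun s j => a s j ω) (h := h) hΓ (by linarith : 0 ≤ C₂) hσ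
      (by positivity : 0 ≤ 1 / (4 * (H : ℝ) ^ 2)) hlam
      (measurable_of_mem_boundedLipschitz (hN g hg)) (hN g hg).2 hkK.2 hzz'
    -- The net resolution is tuned to cancel the factor `K` and leave a power `σ ^ (1 + d₂)`;
    -- dividing by `C ≥ β` then gives the middle term of `theta3`.
    have h3 : K * (C₂ * (σ ^ (2 + d₂) / (H ^ 2 * K) / σ) * (4 * H)) =
        4 * C₂ / H * σ ^ (1 + d₂) := by
      have : σ ^ (2 + d₂) = σ ^ (1 + d₂) * σ := by
        rw [← Real.rpow_add_one hσ.ne']; congr 1; ring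
      rw [this]; field_simp
    rw [h3] at h2
    have h4 := estP_sub_avP_le (P := P) (x := fun s j => x s j ω) (a := fun s j => a s j ω)
      hD hH hΓ hC₁ hC₃ hη₀ hη₁ hσ hβ hLQ hLp (by positivity : 0 ≤ 8 * (LQ * σ)) hkK.1 z
      (fun s hs => hP s (by simp only [Finset.mem_Ico, Finset.mem_Icc] at hs ⊢; omega) h hh)
      hu (hN g hg) hug
    rw [← hCdef] at h4
    simp only [huf] at h4
    have hσp : 0 < σ ^ (1 + d₂) := Real.rpow_pos_of_pos hσ _
    have h5 : deviationSum P Γ σ (1 / (4 * H ^ 2)) (fun s j => x s j ω) (fun s j => a s j ω)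
        k h g z / C ≤ 14 * H ^ 2 * C₂ * Q / C + 4 * C₂ / (H * β) * σ ^ (1 + d₂) := by
      calc _ ≤ (4 * H ^ 2 * Q + 4 * C₂ / H * σ ^ (1 + d₂)) / C := by gcongr; linarith
        _ = 4 * H ^ 2 * 1 * Q / C + 4 * C₂ / H * σ ^ (1 + d₂) / C := by ring
        _ ≤ 14 * H ^ 2 * C₂ * Q / C + 4 * C₂ / H * σ ^ (1 + d₂) / β := by
            gcongr
            norm_num
        _ = _ := by field_simp
    have h6 : 4 * C₂ / (H * β) * σ ^ (1 + d₂) ≤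
        theta3 X A H K Lp LQ σ β C₂ d₂ k δ * σ ^ (1 + d₂) := by
      refine mul_le_mul_of_nonneg_right ?_ hσp.le
      have h7 : 0 ≤ 2 * Lp * LQ * σ / (H ^ 2 * K) := by positivity
      have h8 : 0 ≤ 14 * Q * C₂ / β ^ 2 := by positivity
      rw [theta3, ← hQ]
      linarith
    have h7 : 5 / 2 * (8 * (LQ * σ)) + 6 * Lp * LQ * σ * (1 + √(Real.posLog (C₁ * k / β))) ≤
        theta4 Lp LQ β C₁ k * σ := by
      have : 0 < LQ * σ := by positivity
      rw [theta4]
      linarith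
    have h8 : 1 / (2 * H) * ((∫ y, |f y| ∂(P k h z)) + 2 * biasP P H W LQ β C₃ η k h) ≤
        1 / H * (∫ y, |f y| ∂(P k h z)) + 2 / H * biasP P H W LQ β C₃ η k h := by
      have hf0 : 0 ≤ ∫ y, |f y| ∂(P k h z) := integral_nonneg fun y => abs_nonneg _
      have : 1 / (2 * (H : ℝ)) ≤ 1 / H := by apply one_div_le_one_div_of_le <;> linarith
      calc _ ≤ 1 / (H : ℝ) * ((∫ y, |f y| ∂(P k h z)) + 2 * biasP P H W LQ β C₃ η k h) := by
            gcongr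
        _ = _ := by ring
    rw [add_div]
    linarith
  refine abs_le'.2 ⟨main f hf fun _ => rfl, ?_⟩
  have h1 := main _ (neg_mem_boundedLipschitz hf) fun y => abs_neg _
  rw [estP_neg, avP_neg] at h1
  linarith

end ConfidenceBound

/-! ### Orders of magnitude. -/

section Orders

/-- The logarithmic factor `Λ` of the orders of magnitude. -/
noncomputable def logFactor (H K : ℕ) (LQ σ δ : ℝ) : ℝ :=
  Real.log (Real.exp 1 * K / (δ * σ) * (2 * H / (LQ * σ)))

variable {H K k : ℕ} {LQ σ δ : ℝ}

theorem logFactor_eq (hH : 1 ≤ H) (hK : 1 ≤ K) (hLQ : 0 < LQ) (hσ : 0 < σ) (hδ₀ : 0 < δ) :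
    logFactor H K LQ σ δ =
      1 + Real.log K - Real.log δ - Real.log σ + Real.log (2 * H / (LQ * σ)) := by
  have hK' : (0 : ℝ) < K := by exact_mod_cast hK
  have hH' : (0 : ℝ) < H := by exact_mod_cast hH
  rw [logFactor, Real.log_mul (by positivity) (by positivity),
    Real.log_div (by positivity) (by positivity), Real.log_mul (by positivity) (by positivity),
    Real.log_mul (by positivity) (by positivity), Real.log_exp]
  ring

/-- Every factor inside the logarithm has logarithm at most a constant times `Λ`, except the power,
which gives `covNum X σ * Λ`. Since `covNum X σ ≥ 1`, it absorbs all the others, and `d₁` goes into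
the constant. -/
theorem square3_le_logFactor {X A : Type*} [Nonempty X] [Nonempty A] [MetricSpace X]
    [MetricSpace (X × A)] {d₁ d₂ : ℝ} (hd₁ : HasCoveringDim (X × A) d₁)
    (hd₂ : HasCoveringDim X d₂) (hH : 1 ≤ H) :
    ∃ c : ℝ, 0 ≤ c ∧ ∀ (K k : ℕ) (LQ σ δ : ℝ), 1 ≤ k → k ≤ K → 0 < LQ → 0 < σ → σ ≤ 1 →
      LQ * σ ≤ 2 * H → 0 < δ → δ < 1 →
      square3 X A H K LQ σ d₂ k δ ≤ c * logFactor H K LQ σ δ * covNum X σ := by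
  obtain ⟨hd₁0, c₁, hc₁⟩ := id hd₁
  have hd₂0 := hd₂.1
  have hH' : (1 : ℝ) ≤ H := by exact_mod_cast hH
  have hlogH : 0 ≤ Real.log H := Real.log_nonneg hH'
  have hlogc : 0 ≤ Real.log (max c₁ 1) := Real.log_nonneg (le_max_right _ _)
  have hlog12 : 0 ≤ Real.log 12 := Real.log_nonneg (by norm_num)
  refine ⟨Real.log 12 + 3 + Real.log H + Real.log (max c₁ 1)
    + d₁ * (3 + d₂ + 2 * Real.log H), by positivity, ?_⟩
  intro K k LQ σ δ hk hkK hLQ hσ hσ1 hLQσ hδ₀ hδ₁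
  have hk' : (1 : ℝ) ≤ k := by exact_mod_cast hk
  have hkK' : (k : ℝ) ≤ K := by exact_mod_cast hkK
  have hK' : (1 : ℝ) ≤ K := hk'.trans hkK'
  have hK : 1 ≤ K := hk.trans hkK
  have hΛ := logFactor_eq hH hK hLQ hσ hδ₀
  have hlK : 0 ≤ Real.log K := Real.log_nonneg hK'
  have hlδ : Real.log δ ≤ 0 := Real.log_nonpos hδ₀.le hδ₁.le
  have hlσ : Real.log σ ≤ 0 := Real.log_nonpos hσ.le hσ1
  have hlR : 0 ≤ Real.log (2 * H / (LQ * σ)) :=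
    Real.log_nonneg (one_le_two_mul_div hLQ hσ hLQσ)
  set Λ := logFactor H K LQ σ δ
  have hΛ1 : 1 ≤ Λ := by linarith
  set ε := σ ^ (2 + d₂) / (H ^ 2 * K) with hε
  have hσp : 0 < σ ^ (2 + d₂) := Real.rpow_pos_of_pos hσ _
  have hε0 : 0 < ε := by positivity
  have hε1 : ε ≤ 1 := by
    rw [hε, div_le_one (by positivity)]
    exact (Real.rpow_le_one hσ.le hσ1 (by linarith)).trans
      (one_le_mul_of_one_le_of_one_le (one_le_pow₀ hH') hK')
  have hN : (1 : ℝ) ≤ covNum (X × A) ε := by exact_mod_cast hd₁.one_le_covNum hε0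
  have hNX : (1 : ℝ) ≤ covNum X σ := by exact_mod_cast hd₂.one_le_covNum hσ
  have hlogε : Real.log ε = (2 + d₂) * Real.log σ - (2 * Real.log H + Real.log K) := by
    rw [hε, Real.log_div (by positivity) (by positivity), Real.log_rpow hσ,
      Real.log_mul (by positivity) (by positivity), Real.log_pow]
    norm_num
  have hlogN : Real.log (covNum (X × A) ε) ≤
      (Real.log (max c₁ 1) + d₁ * (3 + d₂ + 2 * Real.log H)) * Λ := by
    have h1 : (covNum (X × A) ε : ℝ) ≤ max c₁ 1 * ε ^ (-d₁) :=
      (hc₁ ε hε0 hε1).2.trans (by gcongr; exact le_max_left _ _)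
    have h2 : 0 < ε ^ (-d₁) := Real.rpow_pos_of_pos hε0 _
    have h3 : Real.log (covNum (X × A) ε) ≤ Real.log (max c₁ 1) + -d₁ * Real.log ε := by
      rw [← Real.log_rpow hε0, ← Real.log_mul (by positivity) h2.ne']
      exact Real.log_le_log (by linarith) h1
    have h4 : -Real.log ε ≤ (3 + d₂ + 2 * Real.log H) * Λ := by
      rw [hlogε]
      have e1 : (2 + d₂) * (-Real.log σ) ≤ (2 + d₂) * Λ :=
        mul_le_mul_of_nonneg_left (by linarith) (by linarith)
      have e2 : 2 * Real.log H * 1 ≤ 2 * Real.log H * Λ :=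
        mul_le_mul_of_nonneg_left hΛ1 (by linarith)
      linarith
    have h5 := mul_le_mul_of_nonneg_left h4 hd₁0
    have h6 := mul_le_mul_of_nonneg_left hΛ1 hlogc
    linarith
  have hlog1 : Real.log (4 * Real.exp 1 * (2 * k + 1) / δ) ≤ (Real.log 12 + 1) * Λ := by
    have h1 : Real.log (4 * Real.exp 1 * (2 * k + 1) / δ) ≤
        Real.log (12 * (Real.exp 1 * K) / δ) := by
      refine Real.log_le_log (by positivity) ?_
      refine div_le_div_of_nonneg_right ?_ hδ₀.le
      nlinarith [Real.exp_pos 1]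
    have h3 : Real.log (12 * (Real.exp 1 * K) / δ) =
        Real.log 12 + (1 + Real.log K) - Real.log δ := by
      rw [Real.log_div (by positivity) hδ₀.ne', Real.log_mul (by norm_num) (by positivity),
        Real.log_mul (by positivity) (by positivity), Real.log_exp]
    have h2 := mul_le_mul_of_nonneg_left hΛ1 hlog12
    linarith
  have hlog2 : Real.log (K * H) ≤ (1 + Real.log H) * Λ := by
    rw [Real.log_mul (by positivity) (by positivity)]
    have h2 := mul_le_mul_of_nonneg_left hΛ1 hlogH
    linarith
  have hR0 : 0 < 2 * H / (LQ * σ) := by positivity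
  have heq : square3 X A H K LQ σ d₂ k δ = Real.log (4 * Real.exp 1 * (2 * k + 1) / δ)
      + Real.log (K * H) + Real.log (covNum (X × A) ε)
      + covNum X σ * Real.log (2 * H / (LQ * σ)) := by
    rw [square3, ← hε, Real.log_mul (by positivity) (by positivity),
      Real.log_mul (by positivity) (by positivity), Real.log_mul (by positivity) (by positivity),
      Real.log_pow]
  rw [heq]
  have hA : 0 ≤ (Real.log 12 + 2 + Real.log H + Real.log (max c₁ 1)
    + d₁ * (3 + d₂ + 2 * Real.log H)) * Λ := by positivity
  have h1 := mul_le_mul_of_nonneg_left hNX hA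
  have h2 : covNum X σ * Real.log (2 * H / (LQ * σ)) ≤ covNum X σ * Λ :=
    mul_le_mul_of_nonneg_left (by linarith) (by linarith)
  linarith

theorem posLog_mul_div_le {C β : ℝ} (hk : 1 ≤ k) :
    Real.posLog (C * k / β) ≤ Real.posLog (C / β) + Real.log k := by
  have h1 : C * k / β = C / β * k := by ring
  rw [h1]
  refine Real.posLog_mul.trans_eq ?_
  rw [Real.posLog_eq_log (x := (k : ℝ)) (by simpa using hk)]

theorem orders_of_magnitude {X A : Type*} [Nonempty X] [Nonempty A] [MetricSpace X]
    [MetricSpace (X × A)] {d₁ d₂ : ℝ} (hd₁ : HasCoveringDim (X × A) d₁)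
    (hd₂ : HasCoveringDim X d₂) (hH : 1 ≤ H) {C₁ C₂ β Lp : ℝ} (hC₂ : 1 ≤ C₂) (hβ : 0 < β)
    (hLp : 0 ≤ Lp) :
    ∃ c : ℝ, 0 < c ∧ ∀ (K k : ℕ) (LQ σ δ : ℝ), 1 ≤ k → k ≤ K → 0 < LQ → 0 < σ → σ ≤ 1 →
        LQ * σ ≤ 2 * H → 0 < δ → δ < 1 →
      square3 X A H K LQ σ d₂ k δ
          ≤ c * logFactor H K LQ σ δ * (covNum X σ + d₁ * d₂) ∧
      theta3 X A H K Lp LQ σ β C₂ d₂ k δ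
          ≤ c * logFactor H K LQ σ δ * (covNum X σ + d₁ * d₂ + LQ * σ) ∧
      theta4 Lp LQ β C₁ k ≤ c * logFactor H K LQ σ δ * LQ ∧
      (covNum X σ : ℝ) ≤ c * σ ^ (-d₂) := by
  obtain ⟨c₀, hc₀, hsq⟩ := square3_le_logFactor hd₁ hd₂ hH
  obtain ⟨hd₂0, c₂, hc₂⟩ := id hd₂
  have hH' : (1 : ℝ) ≤ H := by exact_mod_cast hH
  have hp0 : 0 ≤ Real.posLog (C₁ / β) := Real.posLog_nonneg
  have hdd : 0 ≤ d₁ * d₂ := mul_nonneg hd₁.1 hd₂0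
  set b₃ := 2 * Lp + 4 * C₂ / β + 14 * C₂ / β ^ 2 * c₀ with hb₃
  set b₄ := 32 + 6 * Lp * (3 + Real.posLog (C₁ / β)) with hb₄
  have hb₃0 : 0 ≤ b₃ := by positivity
  have hb₄0 : 0 < b₄ := by positivity
  refine ⟨c₀ + b₃ + b₄ + max c₂ 0, by positivity, ?_⟩
  intro K k LQ σ δ hk hkK hLQ hσ hσ1 hLQσ hδ₀ hδ₁
  have hk' : (1 : ℝ) ≤ k := by exact_mod_cast hk
  have hkK' : (k : ℝ) ≤ K := by exact_mod_cast hkK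
  have hK' : (1 : ℝ) ≤ K := hk'.trans hkK'
  have hΛ := logFactor_eq hH (hk.trans hkK) hLQ hσ hδ₀
  have hlK : 0 ≤ Real.log K := Real.log_nonneg hK'
  have hlδ : Real.log δ ≤ 0 := Real.log_nonpos hδ₀.le hδ₁.le
  have hlσ : Real.log σ ≤ 0 := Real.log_nonpos hσ.le hσ1
  have hlR : 0 ≤ Real.log (2 * H / (LQ * σ)) :=
    Real.log_nonneg (one_le_two_mul_div hLQ hσ hLQσ)
  have hs := hsq K k LQ σ δ hk hkK hLQ hσ hσ1 hLQσ hδ₀ hδ₁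
  set Λ := logFactor H K LQ σ δ
  have hΛ1 : 1 ≤ Λ := by linarith
  have hNX : (1 : ℝ) ≤ covNum X σ := by exact_mod_cast hd₂.one_le_covNum hσ
  have hm0 : 0 ≤ max c₂ 0 := le_max_right _ _
  have hLσ : 0 < LQ * σ := by positivity
  have hweak : ∀ {b t : ℝ}, b ≤ c₀ + b₃ + b₄ + max c₂ 0 → 0 ≤ t →
      b * Λ * t ≤ (c₀ + b₃ + b₄ + max c₂ 0) * Λ * t := fun hb ht => by gcongr
  refine ⟨?_, ?_, ?_, ?_⟩
  · refine le_trans ?_ (hweak (b := c₀) (by linarith) (by positivity))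
    refine hs.trans (mul_le_mul_of_nonneg_left (by linarith) (by positivity))
  · refine le_trans ?_ (hweak (b := b₃) (by linarith) (by positivity))
    have hM1 : 1 ≤ Λ * (covNum X σ + d₁ * d₂ + LQ * σ) :=
      one_le_mul_of_one_le_of_one_le hΛ1 (by linarith)
    have h1 : 2 * Lp * LQ * σ / (H ^ 2 * K) ≤
        2 * Lp * (Λ * (covNum X σ + d₁ * d₂ + LQ * σ)) := by
      calc 2 * Lp * LQ * σ / (H ^ 2 * K) ≤ 2 * Lp * LQ * σ :=
            div_le_self (by positivity)
              (one_le_mul_of_one_le_of_one_le (one_le_pow₀ hH') hK')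
        _ = 2 * Lp * (1 * (LQ * σ)) := by ring
        _ ≤ _ := by gcongr; linarith
    have h2 : 4 * C₂ / (H * β) ≤ 4 * C₂ / β * (Λ * (covNum X σ + d₁ * d₂ + LQ * σ)) := by
      calc 4 * C₂ / (H * β) ≤ 4 * C₂ / β := by
            gcongr
            exact le_mul_of_one_le_left hβ.le hH'
        _ ≤ _ := le_mul_of_one_le_right (by positivity) hM1
    have h3 : 14 * square3 X A H K LQ σ d₂ k δ * C₂ / β ^ 2 ≤
        14 * C₂ / β ^ 2 * c₀ * (Λ * (covNum X σ + d₁ * d₂ + LQ * σ)) := by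
      calc 14 * square3 X A H K LQ σ d₂ k δ * C₂ / β ^ 2
          = 14 * C₂ / β ^ 2 * square3 X A H K LQ σ d₂ k δ := by ring
        _ ≤ 14 * C₂ / β ^ 2 * (c₀ * Λ * covNum X σ) := by gcongr
        _ ≤ 14 * C₂ / β ^ 2 * (c₀ * Λ * (covNum X σ + d₁ * d₂ + LQ * σ)) := by
            gcongr; linarith
        _ = _ := by ring
    rw [theta3, hb₃]
    linarith
  · refine le_trans ?_ (hweak (b := b₄) (by linarith) hLQ.le)
    have hp : Real.posLog (C₁ * k / β) ≤ Real.posLog (C₁ / β) + Real.log k :=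
      posLog_mul_div_le hk
    have hlk : Real.log k ≤ Real.log K := Real.log_le_log (by linarith) hkK'
    -- Giving up the square root costs nothing here, since one full power of `Λ` is allowed.
    have hsqrt : √(Real.posLog (C₁ * k / β)) ≤ 1 + Real.posLog (C₁ * k / β) := by
      refine Real.sqrt_le_iff.2 ⟨by linarith [Real.posLog_nonneg (x := C₁ * k / β)], ?_⟩
      nlinarith [Real.posLog_nonneg (x := C₁ * k / β)]
    have h1 : 1 + √(Real.posLog (C₁ * k / β)) ≤ (3 + Real.posLog (C₁ / β)) * Λ := by
      have := mul_le_mul_of_nonneg_left hΛ1 hp0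
      linarith
    have h2 : 32 * LQ * 1 ≤ 32 * LQ * Λ := by gcongr
    have h3 : 6 * Lp * LQ * (1 + √(Real.posLog (C₁ * k / β))) ≤
        6 * Lp * LQ * ((3 + Real.posLog (C₁ / β)) * Λ) := by gcongr
    rw [theta4, hb₄]
    linarith
  · have hσp : 0 ≤ σ ^ (-d₂) := Real.rpow_nonneg hσ.le _
    refine (hc₂ σ hσ hσ1).2.trans (mul_le_mul_of_nonneg_right ?_ hσp)
    linarith [le_max_left c₂ 0]

end Orders

end KeRNS

theorem mainTheorem2
    {Ω X A : Type*} [mΩ : MeasurableSpace Ω]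
    [Nonempty X] [MetricSpace X] [MeasurableSpace X] [OpensMeasurableSpace X]
    [Nonempty A] [MeasurableSpace A] [MetricSpace (X × A)] [OpensMeasurableSpace (X × A)]
    (μ : Measure Ω) [IsProbabilityMeasure μ]
    (d₁ d₂ : ℝ) (hd₁ : KeRNS.HasCoveringDim (X × A) d₁) (hd₂ : KeRNS.HasCoveringDim X d₂)
    (H : ℕ) (hH : 1 ≤ H)
    (Γ : ℕ → ℝ → ℝ) (C₁ C₂ C₃ η : ℝ) (W : ℕ)
    (hC₁ : 0 < C₁) (hC₂ : 1 ≤ C₂) (hC₃ : 0 ≤ C₃)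
    (hη₀ : 0 < η) (hη₁ : η < 1) (hΓ : KeRNS.IsBaseKernel Γ C₁ C₂ C₃ η W)
    (β Lp : ℝ) (hβ : 0 < β) (hLp : 0 ≤ Lp) :
    -- the confidence bound
    (∀ (K : ℕ) (P : ℕ → ℕ → Kernel (X × A) X) (_ : ∀ k h, IsMarkovKernel (P k h))
        (_ : ∀ k ∈ Finset.Icc 1 K, ∀ h ∈ Finset.Icc 1 H, ∀ z z' : X × A,
          KeRNS.wass (P k h z) (P k h z') ≤ Lp * dist z z')
        (F : Filtration (ℕ ×ₗ ℕ) mΩ) (x : ℕ → ℕ → Ω → X) (a : ℕ → ℕ → Ω → A)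
        (_ : KeRNS.IsInteraction μ P K H F x a)
        (LQ σ δ : ℝ), 0 < LQ → 0 < σ → LQ * σ ≤ 2 * H → 0 < δ → δ < 1 →
      ∃ G : Set Ω, MeasurableSet G ∧ 1 - δ ≤ μ.real G ∧
        ∀ ω ∈ G, ∀ k ∈ Finset.Icc 1 K, ∀ h ∈ Finset.Icc 1 H, ∀ z : X × A,
          ∀ f ∈ KeRNS.boundedLipschitz X (2 * LQ) (2 * H),
            |KeRNS.estP Γ σ β (fun s j => x s j ω) (fun s j => a s j ω) k h f z
              - KeRNS.avP P Γ σ β (fun s j => x s j ω) (fun s j => a s j ω) k h f z|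
            ≤ 1 / H * ∫ y, |f y| ∂(P k h z)
              + (14 * H ^ 2 * C₂ * KeRNS.square3 X A H K LQ σ d₂ k δ + 2 * β * H)
                / KeRNS.count Γ σ β (fun s j => x s j ω) (fun s j => a s j ω) k h z
              + KeRNS.theta3 X A H K Lp LQ σ β C₂ d₂ k δ * σ ^ (1 + d₂)
              + KeRNS.theta4 Lp LQ β C₁ k * σ
              + 2 / H * KeRNS.biasP P H W LQ β C₃ η k h) ∧
    -- the orders of magnitude, up to a constant and a logarithmic factor
    (∃ c : ℝ, 0 < c ∧ ∀ (K k : ℕ) (LQ σ δ : ℝ), 1 ≤ k → k ≤ K → 0 < LQ → 0 < σ → σ ≤ 1 →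
        LQ * σ ≤ 2 * H → 0 < δ → δ < 1 →
      KeRNS.square3 X A H K LQ σ d₂ k δ
          ≤ c * Real.log (Real.exp 1 * K / (δ * σ) * (2 * H / (LQ * σ)))
            * (KeRNS.covNum X σ + d₁ * d₂) ∧
      KeRNS.theta3 X A H K Lp LQ σ β C₂ d₂ k δ
          ≤ c * Real.log (Real.exp 1 * K / (δ * σ) * (2 * H / (LQ * σ)))
            * (KeRNS.covNum X σ + d₁ * d₂ + LQ * σ) ∧
      KeRNS.theta4 Lp LQ β C₁ k
          ≤ c * Real.log (Real.exp 1 * K / (δ * σ) * (2 * H / (LQ * σ))) * LQ ∧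
      (KeRNS.covNum X σ : ℝ) ≤ c * σ ^ (-d₂)) := by
  refine ⟨fun K P _ hP F x a hI LQ σ δ hLQ hσ hLQσ hδ₀ hδ₁ =>
    KeRNS.confidence_bound hd₁ hd₂ hH hC₁ hC₂ hC₃ hη₀ hη₁ hΓ hβ hLp hP hI hLQ hσ hLQσ hδ₀ hδ₁,
    KeRNS.orders_of_magnitude hd₁ hd₂ hH hC₂ hβ hLp⟩
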